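/- Let $H^2$ be the hyperbolic plane of curvature $-1$ with its geodesic distance $d$. For a convex body $K\subset H^2$ (a compact geodesically convex set with non-empty interior), a supporting line of $K$ is a hyperbolic line that meets $K$ and has $K$ in one of its closed half-planes. The width of $K$ with respect to a supporting line $\ell$ is the distance from $\ell$ to a most distant supporting line of $K$, and the minimal width $w(K)$ is the minimum of these widths over all supporting lines. An ordinary reduced polygon is a convex $n$-gon $P\subset H^2$, $n=2k+1\ge 3$ odd, with vertices $v_1,\dots,v_n$ in cyclic order (indices modulo $n$), such that for every $i$ the distance of $v_i$ from the opposite side $[v_{i+k},v_{i+k+1}]$ equals $w(P)$ and the orthogonal projection of $v_i$ onto the line through $v_{i+k}$ and $v_{i+k+1}$ lies in the relative interior of that side. Theorem. If $P\subset H^2$ is an ordinary reduced polygon of minimal width $w=w(P)$, then its diameter satisfies $$\operatorname{diam}(P)\le 2\operatorname{arcosh}\left(\frac{\cosh w+\sqrt{\cosh^2 w+8}}{4}\right),$$ with equality if and only if $P$ is a regular triangle. -/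

import Mathlib

/-! The hyperbolic plane is Mathlib's upper half-plane `ℍ` with its hyperbolic (geodesic) metric
of curvature `-1`. -/

open scoped UpperHalfPlane

noncomputable section

namespace Hyp

/-- The geodesic segment `[x, y]`: the points at which the triangle inequality is an equality. -/
def seg (x y : ℍ) : Set ℍ := {z | dist x z + dist z y = dist x y}

/-- Geodesic convexity. -/
def IsConvex (X : Set ℍ) : Prop := ∀ x ∈ X, ∀ y ∈ X, seg x y ⊆ X

/-- The convex hull: the intersection of all convex sets containing `X`. -/
def hull (X : Set ℍ) : Set ℍ := ⋂₀ {Y | IsConvex Y ∧ X ⊆ Y}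

/-- A convex body: a compact convex set with non-empty interior. -/
structure IsConvexBody (K : Set ℍ) : Prop where
  convex : IsConvex K
  compact : IsCompact K
  interior_nonempty : (interior K).Nonempty

/-- The function `a |z|² + b Re z + c`. If `4ac < b²`, its zero set is a vertical half-line (`a = 0`)
or a half-circle centred on the real axis (`a ≠ 0`), and all of these arise. -/
def form (a b c : ℝ) (z : ℍ) : ℝ := a * Complex.normSq (z : ℂ) + b * z.re + c

/-- `H` is one of the two closed half-planes bounded by the hyperbolic line `l`. -/
def IsHalfPlane (l H : Set ℍ) : Prop :=
  ∃ a b c : ℝ, 4 * a * c < b ^ 2 ∧ l = {z | form a b c z = 0} ∧ H = {z | 0 ≤ form a b c z}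

/-- Hyperbolic lines: vertical half-lines and half-circles centred on the real axis. -/
def IsLine (l : Set ℍ) : Prop :=
  ∃ a b c : ℝ, 4 * a * c < b ^ 2 ∧ l = {z | form a b c z = 0}

/-- `l` is a supporting line of `K`: it meets `K`, and `K` lies in one of the closed half-planes
bounded by `l`. -/
structure IsSupportingLine (K l : Set ℍ) : Prop where
  line : IsLine l
  meets : (K ∩ l).Nonempty
  one_side : ∃ H, IsHalfPlane l H ∧ K ⊆ H

/-- The distance of two sets (here: of two lines), the infimum of the distances of their points. -/
def setDist (A B : Set ℍ) : ℝ := sInf (Set.image2 dist A B)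

/-- The width of `K` with respect to its supporting line `l`: the distance from `l` to a most
distant supporting line of `K`. For a convex body these distances are bounded by the diameter. -/
def width (K l : Set ℍ) : ℝ := sSup {r | ∃ l', IsSupportingLine K l' ∧ r = setDist l l'}

/-- The minimal width (thickness) of `K`: the minimum of the width over all supporting lines. -/
def minWidth (K : Set ℍ) : ℝ := sInf {r | ∃ l, IsSupportingLine K l ∧ r = width K l}

/-- `t` is the orthogonal projection of `p` on the line `l`, i.e. the point of `l` nearest to
`p`. -/
def IsProjection (l : Set ℍ) (p t : ℍ) : Prop := t ∈ l ∧ ∀ s ∈ l, dist p t ≤ dist p s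

/-- `P` is a convex `n`-gon whose vertices, listed in cyclic order, are `v i` for `i` modulo `n`:
it is a convex body, the convex hull of the `v i`; none of these is in the convex hull of the
others; and consecutive ones lie on a common supporting line, so that the segments
`[v i, v (i + 1)]` are the sides. -/
structure IsConvexPolygon {n : ℕ} (P : Set ℍ) (v : ZMod n → ℍ) : Prop where
  body : IsConvexBody P
  injective : Function.Injective v
  eq_hull : P = hull (Set.range v)
  vertex : ∀ i, v i ∉ hull (Set.range v \ {v i})
  side : ∀ i, ∃ l, IsSupportingLine P l ∧ v i ∈ l ∧ v (i + 1) ∈ l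

/-- Ordinary reduced polygons: convex `n`-gons with `n = 2k + 1` odd such that the distance of each
vertex `v i` from the opposite side `[v (i + k), v (i + k + 1)]` is the minimal width of the polygon,
and the orthogonal projection of `v i` on the line through that side is in the relative interior of
the side. -/
def IsOrdinaryReducedPolygon (P : Set ℍ) : Prop :=
  ∃ k : ℕ, 1 ≤ k ∧ ∃ v : ZMod (2 * k + 1) → ℍ, IsConvexPolygon P v ∧
    ∀ i, Metric.infDist (v i) (seg (v (i + k)) (v (i + k + 1))) = minWidth P ∧
      ∃ l t, IsLine l ∧ v (i + k) ∈ l ∧ v (i + k + 1) ∈ l ∧ IsProjection l (v i) t ∧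
        t ∈ seg (v (i + k)) (v (i + k + 1)) \ {v (i + k), v (i + k + 1)}

/-- Regular triangles: non-degenerate triangles with three equal sides (which in the hyperbolic
plane also have three equal angles). -/
def IsRegularTriangle (P : Set ℍ) : Prop :=
  ∃ A B C : ℍ, A ≠ B ∧ dist A B = dist B C ∧ dist B C = dist C A ∧ P = hull {A, B, C}

end Hyp

end

open scoped UpperHalfPlane

noncomputable section

namespace Hyp

/-! The argument takes place on the hyperboloid. Call the perpendicular from a vertex `U m` to its
foot `t m` on the opposite side a rod; all rods have length `w`, and `C = cosh w`. When the vertices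
are numbered in steps of `k + 1`, consecutive rods end on each other's opposite sides, and having
equal length they are mirror images in the perpendicular bisector of `U m` and `U (m + 1)`. Let
`a_m` be the distance from `t m` to `U (m + 1)`. By Pythagoras the chord from `U m` to `U (m + 1)`
has hyperbolic cosine `C cosh a_m`, and by symmetry `U m + t m`, which points to the midpoint of the
rod, changes by `(C + 1) tanh (a_m / 2) (ρ m + ρ (m + 1))`, where `ρ` denotes the unit normals of
the rods.

Sum these changes from rod `p` (odd) to rod `n`, which is rod `0`, and pair the result with a unit
vector `Y`. With `b_m = (-1)^(m+1) ⟨ρ m, Y⟩` this is an alternating sum of the terms `tanh (a_m / 2)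
(b_m - b_(m+1))`. Take for `Y` the normal of a rod turning from one position to the next, at the
moment when it is perpendicular to the chord from `U 0` to `U p`. Since each rod separates the
vertices alternately, `b` first increases and then decreases. Its values at the top are at most 1,
so its total variation is at most `2 - b_p - b_n` (`displacement_le`).

Let `c` be the hyperbolic cosine of half the side of the regular triangle of height `w`; thus `2c² =
Cc + 1`, and the side itself has hyperbolic cosine `Cc`. For `p = 1` and the largest `a_m` placed at
`m = 0`, the estimate yields `cosh a_0 ≤ c`, strictly if `n ≥ 5`, because some term then has the
wrong sign (`two_mul_ch_sq_le`). This settles triangles. For `n ≥ 5` the strict bound is fed back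
into the estimate: a longest chord of hyperbolic cosine at least `Cc` would displace the midpoints
too far (`angle_estimate`, `chord_estimate`, `chord_lt`). Equality therefore needs `n = 3`, where
the relation between the sides makes all of them equal. -/

/-- The Lorentz form of signature `(-,+,+)` on `ℝ³`. -/
def lor (a b : Fin 3 → ℝ) : ℝ := -(a 0 * b 0) + a 1 * b 1 + a 2 * b 2

/-- The cross product adapted to the Lorentz form: `lor (lcross a b) c = det (a, b, c)`. -/
def lcross (a b : Fin 3 → ℝ) : Fin 3 → ℝ :=
  ![-(a 1 * b 2 - a 2 * b 1), a 2 * b 0 - a 0 * b 2, a 0 * b 1 - a 1 * b 0]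

/-- The determinant of three vectors. -/
def det3 (a b c : Fin 3 → ℝ) : ℝ := lor (lcross a b) c

/-! ### Lorentzian linear algebra in dimension three -/

section LinearAlgebra

variable (a b c d : Fin 3 → ℝ) (r : ℝ)

lemma lor_comm : lor a b = lor b a := by simp only [lor]; ring

@[simp] lemma lor_add_left : lor (a + b) c = lor a c + lor b c := by
  simp only [lor, Pi.add_apply]; ring

@[simp] lemma lor_add_right : lor a (b + c) = lor a b + lor a c := by
  simp only [lor, Pi.add_apply]; ring

@[simp] lemma lor_sub_left : lor (a - b) c = lor a c - lor b c := by
  simp only [lor, Pi.sub_apply]; ring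

@[simp] lemma lor_sub_right : lor a (b - c) = lor a b - lor a c := by
  simp only [lor, Pi.sub_apply]; ring

@[simp] lemma lor_smul_left : lor (r • a) b = r * lor a b := by
  simp only [lor, Pi.smul_apply, smul_eq_mul]; ring

@[simp] lemma lor_smul_right : lor a (r • b) = r * lor a b := by
  simp only [lor, Pi.smul_apply, smul_eq_mul]; ring

@[simp] lemma lor_zero_left : lor 0 a = 0 := by simp [lor]

lemma lor_lcross_lcross :
    lor (lcross a b) (lcross c d) = lor a d * lor b c - lor a c * lor b d := by
  simp only [lor, lcross, Matrix.cons_val_zero, Matrix.cons_val_one, Matrix.cons_val]; ring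

@[simp] lemma lor_lcross_left : lor (lcross a b) a = 0 := by
  simp only [lor, lcross, Matrix.cons_val_zero, Matrix.cons_val_one, Matrix.cons_val]; ring

@[simp] lemma lor_lcross_right : lor (lcross a b) b = 0 := by
  simp only [lor, lcross, Matrix.cons_val_zero, Matrix.cons_val_one, Matrix.cons_val]; ring

lemma det3_rotate : det3 b c a = det3 a b c := by
  simp only [det3, lor, lcross, Matrix.cons_val_zero, Matrix.cons_val_one, Matrix.cons_val]; ring

lemma det3_swap : det3 a c b = -det3 a b c := by
  simp only [det3, lor, lcross, Matrix.cons_val_zero, Matrix.cons_val_one, Matrix.cons_val]; ring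

lemma det3_self_left : det3 a b a = 0 := lor_lcross_left a b

lemma det3_self_right : det3 a b b = 0 := lor_lcross_right a b

lemma det3_comb_mid (p q : ℝ) (e : Fin 3 → ℝ) :
    det3 a (p • b + q • c) e = p * det3 a b e + q * det3 a c e := by
  simp only [det3, lor, lcross, Matrix.cons_val_zero, Matrix.cons_val_one, Matrix.cons_val,
    Pi.add_apply, Pi.smul_apply, smul_eq_mul]
  ring

/-- The Plücker relation for four vectors seen from a fifth one. -/
lemma det3_plucker (o p : Fin 3 → ℝ) :
    det3 o p b * det3 o c d - det3 o p c * det3 o b d + det3 o p d * det3 o b c = 0 := by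
  simp only [det3, lor, lcross, Matrix.cons_val_zero, Matrix.cons_val_one, Matrix.cons_val]; ring

/-- Cramer's rule. -/
lemma det3_smul_eq (z : Fin 3 → ℝ) :
    det3 a b c • z = lor z a • lcross b c + lor z b • lcross c a + lor z c • lcross a b := by
  funext i
  fin_cases i <;>
    simp [det3, lor, lcross, Matrix.cons_val_zero, Matrix.cons_val_one, Matrix.cons_val,
      Pi.add_apply, Pi.smul_apply, smul_eq_mul] <;> ring

/-- A vector orthogonal to `a`, `b` and `a × b` vanishes. -/
lemma eq_zero_of_orthogonal {a b z : Fin 3 → ℝ} (h : lor (lcross a b) (lcross a b) ≠ 0)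
    (ha : lor z a = 0) (hb : lor z b = 0) (hab : lor z (lcross a b) = 0) : z = 0 := by
  have := det3_smul_eq a b (lcross a b) z
  rw [ha, hb, hab] at this
  simp only [zero_smul, add_zero, det3] at this
  exact (smul_eq_zero.mp this).resolve_left h

/-- A vector orthogonal to `a` and `b` is a multiple of `a × b`. -/
lemma exists_smul_lcross {a b z : Fin 3 → ℝ} (h : lor (lcross a b) (lcross a b) ≠ 0)
    (ha : lor z a = 0) (hb : lor z b = 0) : ∃ r : ℝ, z = r • lcross a b := by
  refine ⟨lor z (lcross a b) / lor (lcross a b) (lcross a b), ?_⟩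
  rw [← sub_eq_zero]
  apply eq_zero_of_orthogonal h
  · simp [ha]
  · simp [hb]
  · simp only [lor_sub_left, lor_smul_left]
    field_simp
    ring

/-- The Lorentz form is positive definite on the orthogonal complement of a timelike vector. -/
lemma lor_self_pos {u z : Fin 3 → ℝ} (hu : lor u u = -1) (hz : lor z u = 0) (h0 : z ≠ 0) :
    0 < lor z z := by
  simp only [lor] at *
  have h1 : 0 < z 1 ^ 2 + z 2 ^ 2 ∨ (z 1 = 0 ∧ z 2 = 0) := by
    by_cases h1 : z 1 = 0
    · by_cases h2 : z 2 = 0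
      · exact Or.inr ⟨h1, h2⟩
      · left; positivity
    · left; positivity
  have hu0 : 1 ≤ u 0 ^ 2 := by nlinarith [sq_nonneg (u 1), sq_nonneg (u 2)]
  rcases h1 with h1 | ⟨h1, h2⟩
  · have h3 : z 0 * u 0 = z 1 * u 1 + z 2 * u 2 := by linarith
    have h4 : z 0 ^ 2 * u 0 ^ 2 = (z 1 * u 1 + z 2 * u 2) ^ 2 := by rw [← h3]; ring
    have h5 : z 0 ^ 2 * u 0 ^ 2 ≤ (z 1 ^ 2 + z 2 ^ 2) * (u 0 ^ 2 - 1) := by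
      have : u 0 ^ 2 - 1 = u 1 ^ 2 + u 2 ^ 2 := by linarith
      rw [h4, this]
      nlinarith [sq_nonneg (z 1 * u 2 - z 2 * u 1)]
    have h6 : 0 < u 0 ^ 2 * (-(z 0 * z 0) + z 1 * z 1 + z 2 * z 2) := by nlinarith
    exact pos_of_mul_pos_right h6 (by positivity)
  · exfalso
    apply h0
    have h3 : z 0 = 0 := by
      have : z 0 * u 0 = 0 := by rw [h1, h2] at hz; linarith
      rcases mul_eq_zero.mp this with h | h
      · exact h
      · rw [h] at hu0; norm_num at hu0
    funext i
    fin_cases i <;> simp [h1, h2, h3]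

end LinearAlgebra

/-! ### The hyperboloid model: segments, convexity and hulls -/

/-- The embedding of the upper half-plane as a sheet of the hyperboloid `lor u u = -1`. -/
def emb (z : ℍ) : Fin 3 → ℝ :=
  ![(Complex.normSq z + 1) / (2 * z.im), (Complex.normSq z - 1) / (2 * z.im), z.re / z.im]

lemma emb_zero_pos (z : ℍ) : 0 < emb z 0 := by
  have := z.im_pos
  have := Complex.normSq_nonneg (z : ℂ)
  simp only [emb, Matrix.cons_val_zero]
  positivity

lemma lor_emb (z w : ℍ) : lor (emb z) (emb w) = -Real.cosh (dist z w) := by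
  have hz := z.im_pos.ne'
  have hw := w.im_pos.ne'
  rw [UpperHalfPlane.cosh_dist, Complex.dist_eq, ← Complex.normSq_eq_norm_sq]
  simp only [lor, emb, Matrix.cons_val_zero, Matrix.cons_val_one, Matrix.cons_val,
    Complex.normSq_apply, Complex.sub_re, Complex.sub_im, UpperHalfPlane.coe_re,
    UpperHalfPlane.coe_im]
  field_simp
  ring

lemma lor_emb_self (z : ℍ) : lor (emb z) (emb z) = -1 := by simp [lor_emb]

lemma cosh_eq_one_imp {x : ℝ} (h : Real.cosh x ≤ 1) : x = 0 := by
  by_contra hx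
  exact absurd h (not_le.mpr (Real.one_lt_cosh.mpr hx))

lemma cosh_inj {x y : ℝ} (hx : 0 ≤ x) (hy : 0 ≤ y) (h : Real.cosh x = Real.cosh y) : x = y := by
  have h1 := Real.cosh_le_cosh.mp h.le
  have h2 := Real.cosh_le_cosh.mp h.ge
  rw [abs_of_nonneg hx, abs_of_nonneg hy] at h1 h2
  exact le_antisymm h1 h2

lemma emb_injective : Function.Injective emb := by
  intro z w h
  have h1 := lor_emb z w
  rw [h, lor_emb_self] at h1
  exact dist_eq_zero.mp (cosh_eq_one_imp (by linarith))

lemma exists_emb_eq {f : Fin 3 → ℝ} (hf : lor f f = -1) (h0 : 0 < f 0) : ∃ z, emb z = f := by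
  simp only [lor] at hf
  have hd : 0 < f 0 - f 1 := by nlinarith [sq_nonneg (f 2)]
  refine ⟨⟨⟨f 2 / (f 0 - f 1), 1 / (f 0 - f 1)⟩, by simpa using hd⟩, ?_⟩
  have hn : f 2 * f 2 = (f 0 - f 1) * (f 0 + f 1) - 1 := by linarith
  have hd' := hd.ne'
  funext i
  fin_cases i
  · simp [emb, Complex.normSq_apply, UpperHalfPlane.re, UpperHalfPlane.im]
    field_simp
    nlinarith
  · simp [emb, Complex.normSq_apply, UpperHalfPlane.re, UpperHalfPlane.im]
    field_simp
    nlinarith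
  · simp [emb, UpperHalfPlane.re, UpperHalfPlane.im]
    field_simp

/-- The normal vector of the line `form a b c = 0`. -/
def normal (a b c : ℝ) : Fin 3 → ℝ := ![-(a + c), a - c, b]

lemma form_eq (a b c : ℝ) (z : ℍ) : form a b c z = z.im * lor (normal a b c) (emb z) := by
  have := z.im_pos.ne'
  simp only [form, lor, normal, emb, Matrix.cons_val_zero, Matrix.cons_val_one, Matrix.cons_val]
  field_simp
  ring

lemma form_eq_zero_iff (a b c : ℝ) (z : ℍ) :
    form a b c z = 0 ↔ lor (normal a b c) (emb z) = 0 := by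
  rw [form_eq, mul_eq_zero, or_iff_right z.im_pos.ne']

lemma form_nonneg_iff (a b c : ℝ) (z : ℍ) :
    0 ≤ form a b c z ↔ 0 ≤ lor (normal a b c) (emb z) := by
  rw [form_eq, mul_nonneg_iff_of_pos_left z.im_pos]

lemma lor_normal (a b c : ℝ) : lor (normal a b c) (normal a b c) = b ^ 2 - 4 * a * c := by
  simp only [lor, normal, Matrix.cons_val_zero, Matrix.cons_val_one, Matrix.cons_val]; ring

section Segments

variable {x y z : ℍ}

/-- A point of a geodesic segment is a combination of the end points, in the hyperboloid model. -/
lemma sinh_smul_emb_of_mem_seg (h : z ∈ seg x y) :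
    Real.sinh (dist x y) • emb z =
      Real.sinh (dist z y) • emb x + Real.sinh (dist x z) • emb y := by
  have hd : dist x z + dist z y = dist x y := h
  have h1 : ∀ w : ℍ, lor (Real.sinh (dist x y) • emb z - (Real.sinh (dist z y) • emb x
      + Real.sinh (dist x z) • emb y)) (emb w) = -(Real.sinh (dist x y) * Real.cosh (dist z w))
      + Real.sinh (dist z y) * Real.cosh (dist x w)
      + Real.sinh (dist x z) * Real.cosh (dist y w) := by
    intro w; simp only [lor_sub_left, lor_add_left, lor_smul_left, lor_emb]; ring
  have hx := h1 x
  have hy := h1 y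
  have hz := h1 z
  simp only [dist_self, Real.cosh_zero, dist_comm z x, dist_comm y x, dist_comm y z, ← hd,
    Real.sinh_add, Real.cosh_add] at hx hy hz
  have sq1 := Real.cosh_sq (dist x z)
  have sq2 := Real.cosh_sq (dist z y)
  have hx0 : lor (Real.sinh (dist x y) • emb z - (Real.sinh (dist z y) • emb x
      + Real.sinh (dist x z) • emb y)) (emb x) = 0 := by
    rw [← hd, Real.sinh_add, hx]
    linear_combination (-Real.sinh (dist z y)) * sq1
  have hy0 : lor (Real.sinh (dist x y) • emb z - (Real.sinh (dist z y) • emb x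
      + Real.sinh (dist x z) • emb y)) (emb y) = 0 := by
    rw [← hd, Real.sinh_add, hy]
    linear_combination (-Real.sinh (dist x z)) * sq2
  have hz0 : lor (Real.sinh (dist x y) • emb z - (Real.sinh (dist z y) • emb x
      + Real.sinh (dist x z) • emb y)) (emb z) = 0 := by
    rw [← hd, Real.sinh_add, hz]; ring
  rw [← sub_eq_zero]
  -- The difference of the two sides is orthogonal to `emb x`, `emb y` and `emb z`, hence to itself,
  -- although the form is positive definite on the complement of `emb x`.
  by_contra hne
  have hpos := lor_self_pos (lor_emb_self x) hx0 hne
  rw [lor_sub_right, lor_add_right, lor_smul_right, lor_smul_right, lor_smul_right, hx0, hy0,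
    hz0] at hpos
  simp at hpos

lemma exists_comb_of_mem_seg (h : z ∈ seg x y) :
    ∃ p q : ℝ, 0 ≤ p ∧ 0 ≤ q ∧ emb z = p • emb x + q • emb y := by
  by_cases hxy : x = y
  · subst hxy
    have h1 : dist x z + dist z x = dist x x := h
    rw [dist_self, dist_comm z x] at h1
    have h2 : x = z := dist_eq_zero.mp (by linarith)
    exact ⟨1, 0, zero_le_one, le_rfl, by simp [h2]⟩
  · have hpos : 0 < Real.sinh (dist x y) := Real.sinh_pos_iff.mpr (dist_pos.mpr hxy)
    refine ⟨Real.sinh (dist z y) / Real.sinh (dist x y),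
      Real.sinh (dist x z) / Real.sinh (dist x y), ?_, ?_, ?_⟩
    · exact div_nonneg (Real.sinh_nonneg_iff.mpr dist_nonneg) hpos.le
    · exact div_nonneg (Real.sinh_nonneg_iff.mpr dist_nonneg) hpos.le
    · have h1 := sinh_smul_emb_of_mem_seg h
      calc emb z = (Real.sinh (dist x y))⁻¹ • (Real.sinh (dist x y) • emb z) := by
            rw [smul_smul, inv_mul_cancel₀ hpos.ne', one_smul]
        _ = _ := by rw [h1, smul_add, smul_smul, smul_smul]; congr 2 <;> ring

/-- The products with the end points give `sinh (dist x z) = q sinh (dist x y)` and `sinh (dist z y)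
= p sinh (dist x y)`; the addition theorem for `cosh` then shows that the two distances add up. -/
lemma mem_seg_of_comb {p q : ℝ} (hp : 0 ≤ p) (hq : 0 ≤ q)
    (h : emb z = p • emb x + q • emb y) : z ∈ seg x y := by
  set E := Real.cosh (dist x y) with hE
  set S := Real.sinh (dist x y) with hS
  have hES : E ^ 2 = S ^ 2 + 1 := Real.cosh_sq _
  have hS0 : 0 ≤ S := Real.sinh_nonneg_iff.mpr dist_nonneg
  have hxy : lor (emb x) (emb y) = -E := lor_emb x y
  have hyx : lor (emb y) (emb x) = -E := by rw [lor_comm, hxy]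
  have hxx := lor_emb_self x
  have hyy := lor_emb_self y
  have h1 : p ^ 2 + q ^ 2 + 2 * p * q * E = 1 := by
    have := lor_emb_self z
    rw [h] at this
    simp only [lor_add_left, lor_add_right, lor_smul_left, lor_smul_right, hxx, hyy, hxy, hyx]
      at this
    linarith
  have c1 : Real.cosh (dist x z) = p + q * E := by
    have := lor_emb x z
    rw [h] at this
    simp only [lor_add_right, lor_smul_right, hxx, hxy] at this
    linarith
  have c2 : Real.cosh (dist z y) = p * E + q := by
    have := lor_emb z y
    rw [h] at this
    simp only [lor_add_left, lor_smul_left, hyy, hxy] at this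
    linarith
  have s1 : Real.sinh (dist x z) = q * S := by
    have h2 : 0 ≤ Real.sinh (dist x z) := Real.sinh_nonneg_iff.mpr dist_nonneg
    have h3 := Real.cosh_sq (dist x z)
    rw [c1] at h3
    rw [← abs_of_nonneg h2, ← abs_of_nonneg (mul_nonneg hq hS0)]
    apply (sq_eq_sq_iff_abs_eq_abs _ _).mp
    linear_combination (-1) * h3 + q ^ 2 * hES + h1
  have s2 : Real.sinh (dist z y) = p * S := by
    have h2 : 0 ≤ Real.sinh (dist z y) := Real.sinh_nonneg_iff.mpr dist_nonneg
    have h3 := Real.cosh_sq (dist z y)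
    rw [c2] at h3
    rw [← abs_of_nonneg h2, ← abs_of_nonneg (mul_nonneg hp hS0)]
    apply (sq_eq_sq_iff_abs_eq_abs _ _).mp
    linear_combination (-1) * h3 + p ^ 2 * hES + h1
  have key : Real.cosh (dist x z + dist z y) = Real.cosh (dist x y) := by
    rw [Real.cosh_add, c1, c2, s1, s2, ← hE]
    linear_combination E * h1 - p * q * hES
  change dist x z + dist z y = dist x y
  exact cosh_inj (by positivity) dist_nonneg key

lemma isConvex_lor_pos (N : Fin 3 → ℝ) : IsConvex {z | 0 < lor N (emb z)} := by
  intro x hx y hy z hz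
  obtain ⟨p, q, hp, hq, h⟩ := exists_comb_of_mem_seg hz
  simp only [Set.mem_ofPred_eq] at *
  have h0 := emb_zero_pos z
  rw [h] at h0 ⊢
  rw [lor_add_right, lor_smul_right, lor_smul_right]
  rcases hp.eq_or_lt with rfl | hp'
  · rcases hq.eq_or_lt with rfl | hq'
    · simp at h0
    · have := mul_pos hq' hy; linarith
  · have := mul_pos hp' hx; positivity

/-- Along a segment `cosh (dist · c)` is a combination of its values at the ends whose weights have
sum at most 1, because `sinh` is superadditive. -/
lemma isConvex_closedBall (c : ℍ) (r : ℝ) : IsConvex (Metric.closedBall c r) := by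
  intro x hx y hy z hz
  rw [Metric.mem_closedBall] at *
  by_cases hxy : x = y
  · subst hxy
    have h1 : dist x z + dist z x = dist x x := hz
    rw [dist_self, dist_comm z x] at h1
    have h2 : x = z := dist_eq_zero.mp (by linarith)
    exact h2 ▸ hx
  have hr : 0 ≤ r := dist_nonneg.trans hx
  have hpos : 0 < Real.sinh (dist x y) := Real.sinh_pos_iff.mpr (dist_pos.mpr hxy)
  have h1 := congrArg (fun f => lor f (emb c)) (sinh_smul_emb_of_mem_seg hz)
  simp only [lor_add_left, lor_smul_left, lor_emb] at h1
  have hx' : Real.cosh (dist x c) ≤ Real.cosh r := by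
    rw [Real.cosh_le_cosh, abs_of_nonneg dist_nonneg, abs_of_nonneg hr]; exact hx
  have hy' : Real.cosh (dist y c) ≤ Real.cosh r := by
    rw [Real.cosh_le_cosh, abs_of_nonneg dist_nonneg, abs_of_nonneg hr]; exact hy
  have s1 : 0 ≤ Real.sinh (dist z y) := Real.sinh_nonneg_iff.mpr dist_nonneg
  have s2 : 0 ≤ Real.sinh (dist x z) := Real.sinh_nonneg_iff.mpr dist_nonneg
  have hd : dist x z + dist z y = dist x y := hz
  have hs : Real.sinh (dist z y) + Real.sinh (dist x z) ≤ Real.sinh (dist x y) := by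
    rw [← hd, Real.sinh_add]
    nlinarith [Real.one_le_cosh (dist x z), Real.one_le_cosh (dist z y)]
  have h2 : Real.sinh (dist x y) * Real.cosh (dist z c) ≤
      Real.sinh (dist x y) * Real.cosh r := by
    nlinarith [Real.cosh_pos r]
  have h3 := le_of_mul_le_mul_left h2 hpos
  rwa [Real.cosh_le_cosh, abs_of_nonneg dist_nonneg, abs_of_nonneg hr] at h3

end Segments

section Hull

lemma subset_hull (X : Set ℍ) : X ⊆ hull X := fun _ hx _ hY => hY.2 hx

lemma isConvex_hull (X : Set ℍ) : IsConvex (hull X) :=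
  fun x hx y hy _ hz Y hY => hY.1 x (hx Y hY) y (hy Y hY) hz

lemma hull_subset {X Y : Set ℍ} (hY : IsConvex Y) (h : X ⊆ Y) : hull X ⊆ Y :=
  fun _ hx => hx Y ⟨hY, h⟩

/-- Balls are convex. Those around points of `X` contain the hull, and therefore so do those around
points of the hull. -/
lemma dist_le_of_mem_hull {X : Set ℍ} {D : ℝ} (hD : ∀ x ∈ X, ∀ y ∈ X, dist x y ≤ D)
    {x y : ℍ} (hx : x ∈ hull X) (hy : y ∈ hull X) : dist x y ≤ D := by
  have h1 : ∀ a ∈ X, ∀ b ∈ hull X, dist b a ≤ D := fun a ha b hb =>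
    Metric.mem_closedBall.mp (hull_subset (isConvex_closedBall a D)
      (fun c hc => Metric.mem_closedBall.mpr (hD c hc a ha)) hb)
  have h2 := hull_subset (isConvex_closedBall x D)
    (fun c hc => Metric.mem_closedBall.mpr (by rw [dist_comm]; exact h1 c hc x hx)) hy
  rw [dist_comm]
  exact Metric.mem_closedBall.mp h2

end Hull

/-! ### Chains of rods: the position of consecutive rods -/

/-- A closed chain of rods, in the hyperboloid model. The `m`-th rod joins `U m` to `t m` and has
length `arcosh C`; `ρ m` is the unit normal of its line. The point `U (m + 1)` lies on the
perpendicular to the `m`-th rod at `t m`, and `U m` lies on the perpendicular to the next rod at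
`t (m + 1)`, at the same distance, of which `ch m` and `sh m` are the hyperbolic cosine and sine.
The other points `U` lie alternately on the two sides of each rod. -/
structure IsRodSystem (n : ℕ) (C s : ℝ) (U t ρ : ℕ → Fin 3 → ℝ) (ch sh : ℕ → ℝ) : Prop where
  one_lt : 1 < C
  s_pos : 0 < s
  s_sq : s ^ 2 = C ^ 2 - 1
  U_self : ∀ m, lor (U m) (U m) = -1
  t_self : ∀ m, lor (t m) (t m) = -1
  U_t : ∀ m, lor (U m) (t m) = -C
  ρ_eq : ∃ ε : ℝ, ε ^ 2 = 1 ∧ ∀ m, ρ m = (ε / s) • lcross (U m) (t m)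
  fwd : ∀ m, U (m + 1) = ch m • t m + sh m • ρ m
  bwd : ∀ m, U m = ch m • t (m + 1) - sh m • ρ (m + 1)
  sh_pos : ∀ m, 0 < sh m
  ch_pos : ∀ m, 0 < ch m
  ch_sq : ∀ m, ch m ^ 2 = sh m ^ 2 + 1
  sep : ∀ m q, 1 ≤ q → q < n → 0 < (-1) ^ (q + 1) * lor (ρ m) (U (m + q))
  U_per : ∀ m, U (m + n) = U m
  t_per : ∀ m, t (m + n) = t m
  ρ_per : ∀ m, ρ (m + n) = ρ m

namespace IsRodSystem

variable {n : ℕ} {C s : ℝ} {U t ρ : ℕ → Fin 3 → ℝ} {ch sh : ℕ → ℝ}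

section Frame

variable (h : IsRodSystem n C s U t ρ ch sh) (m : ℕ)
include h

lemma t_U : lor (t m) (U m) = -C := by rw [lor_comm, h.U_t]

lemma ρ_U : lor (ρ m) (U m) = 0 := by
  obtain ⟨ε, -, h1⟩ := h.ρ_eq
  rw [h1, lor_smul_left, lor_lcross_left, mul_zero]

lemma ρ_t : lor (ρ m) (t m) = 0 := by
  obtain ⟨ε, -, h1⟩ := h.ρ_eq
  rw [h1, lor_smul_left, lor_lcross_right, mul_zero]

lemma ρ_self : lor (ρ m) (ρ m) = 1 := by
  obtain ⟨ε, h0, h1⟩ := h.ρ_eq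
  have hs := h.s_pos.ne'
  rw [h1, lor_smul_left, lor_smul_right, lor_lcross_lcross, h.U_t, h.t_U, h.U_self, h.t_self]
  field_simp
  linear_combination (C ^ 2 - 1) * h0 - h.s_sq

lemma one_lt_ch : 1 < ch m := by
  nlinarith [h.ch_sq m, h.sh_pos m, h.ch_pos m]

lemma C_mul_ch_pos : 0 < C * ch m - 1 := by
  nlinarith [h.one_lt, h.one_lt_ch m]

lemma U_succ : lor (U m) (U (m + 1)) = -(C * ch m) := by
  rw [h.fwd, lor_add_right, lor_smul_right, lor_smul_right, h.U_t, lor_comm _ (ρ m), h.ρ_U]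
  ring

lemma succ_U : lor (U (m + 1)) (U m) = -(C * ch m) := by rw [lor_comm, h.U_succ]

lemma t_U_succ : lor (t m) (U (m + 1)) = -ch m := by
  rw [h.fwd, lor_add_right, lor_smul_right, lor_smul_right, h.t_self, lor_comm _ (ρ m), h.ρ_t]
  ring

lemma ρ_U_succ : lor (ρ m) (U (m + 1)) = sh m := by
  rw [h.fwd, lor_add_right, lor_smul_right, lor_smul_right, h.ρ_self, h.ρ_t]
  ring

lemma t_succ_U : lor (t (m + 1)) (U m) = -ch m := by
  conv_lhs => rw [h.bwd]
  rw [lor_sub_right, lor_smul_right, lor_smul_right, h.t_self, lor_comm _ (ρ _), h.ρ_t]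
  ring

lemma ρ_succ_U : lor (ρ (m + 1)) (U m) = -sh m := by
  conv_lhs => rw [h.bwd]
  rw [lor_sub_right, lor_smul_right, lor_smul_right, h.ρ_self, h.ρ_t]
  ring

lemma lor_lcross_succ : 0 < lor (lcross (U m) (U (m + 1))) (lcross (U m) (U (m + 1))) := by
  rw [lor_lcross_lcross, h.U_self, h.U_self, h.U_succ, h.succ_U]
  nlinarith [h.C_mul_ch_pos m]

lemma ρ_add_lcross : lor (ρ m + ρ (m + 1)) (lcross (U m) (U (m + 1))) = 0 := by
  obtain ⟨ε, -, h1⟩ := h.ρ_eq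
  rw [lor_add_left, h1, h1, lor_smul_left, lor_smul_left, lor_lcross_lcross, lor_lcross_lcross,
    h.t_U_succ, h.t_succ_U, h.t_U, h.t_U, h.U_self, h.U_self, h.U_succ, h.succ_U]
  ring

/-- By `fwd` and `bwd`, `U (m + 1)` and `U m` have opposite heights `sh m` and `-sh m` over each
other's rods; both heights are determinants, which gives the equality. -/
lemma t_sub_lcross : lor (t (m + 1) - t m) (lcross (U m) (U (m + 1))) = 0 := by
  obtain ⟨ε, h0, h1⟩ := h.ρ_eq
  have hε : ε ≠ 0 := by rintro rfl; norm_num at h0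
  have e1 : lor (ρ m) (U (m + 1)) = (ε / s) * det3 (U m) (t m) (U (m + 1)) := by
    rw [h1, lor_smul_left]; rfl
  have e2 : lor (ρ (m + 1)) (U m) = (ε / s) * det3 (U (m + 1)) (t (m + 1)) (U m) := by
    rw [h1, lor_smul_left]; rfl
  rw [h.ρ_U_succ] at e1
  rw [h.ρ_succ_U] at e2
  have e3 : (ε / s) * (det3 (U m) (t m) (U (m + 1)) + det3 (U (m + 1)) (t (m + 1)) (U m)) = 0 := by
    linarith
  have e4 := (mul_eq_zero.mp e3).resolve_left (div_ne_zero hε h.s_pos.ne')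
  rw [lor_comm, lor_sub_right]
  change det3 (U m) (U (m + 1)) (t (m + 1)) - det3 (U m) (U (m + 1)) (t m) = 0
  rw [det3_swap (U m) (t m), ← det3_rotate (U m)]
  linarith

/-- Consecutive rods are mirror images of each other in the perpendicular bisector of
`U m` and `U (m + 1)`. -/
lemma ρ_add : ρ m + ρ (m + 1) = (sh m / (C * ch m - 1)) • (U (m + 1) - U m) := by
  have hc := (h.C_mul_ch_pos m).ne'
  rw [← sub_eq_zero]
  apply eq_zero_of_orthogonal (h.lor_lcross_succ m).ne'
  · simp only [lor_sub_left, lor_add_left, lor_smul_left, h.ρ_U, h.ρ_succ_U, h.succ_U, h.U_self]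
    field_simp
    ring
  · simp only [lor_sub_left, lor_add_left, lor_smul_left, h.ρ_U, h.ρ_U_succ, h.U_succ, h.U_self]
    field_simp
    ring
  · rw [lor_sub_left, h.ρ_add_lcross, lor_smul_left, lor_sub_left, lor_comm (U (m + 1)),
      lor_lcross_right, lor_comm (U m), lor_lcross_left]
    ring

/-- The displacement of the midpoint of the rods. -/
lemma midpoint_sub : ((C + 1) * (sh m / (1 + ch m))) • (ρ m + ρ (m + 1)) =
    (U (m + 1) + t (m + 1)) - (U m + t m) := by
  have hc : (1 + ch m) ≠ 0 := by linarith [h.ch_pos m]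
  have hsq := h.ch_sq m
  rw [← sub_eq_zero]
  apply eq_zero_of_orthogonal (h.lor_lcross_succ m).ne'
  · simp only [lor_sub_left, lor_add_left, lor_smul_left, h.ρ_U, h.ρ_succ_U, h.succ_U, h.U_self,
      h.t_succ_U, h.t_U]
    field_simp
    linear_combination (1 + C) * hsq
  · simp only [lor_sub_left, lor_add_left, lor_smul_left, h.ρ_U, h.ρ_U_succ, h.U_succ, h.U_self,
      h.t_U_succ, h.t_U]
    field_simp
    linear_combination (-(1 + C)) * hsq
  · have h1 := h.t_sub_lcross m
    rw [lor_sub_left] at h1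
    rw [lor_sub_left, lor_smul_left, h.ρ_add_lcross, lor_sub_left, lor_add_left, lor_add_left,
      lor_comm (U (m + 1)), lor_lcross_right, lor_comm (U m), lor_lcross_left]
    linarith

lemma ρ_succ : lor (ρ m) (ρ (m + 1)) = -1 + sh m ^ 2 / (C * ch m - 1) := by
  have h1 := congrArg (lor (ρ m)) (h.ρ_add m)
  rw [lor_add_right, lor_smul_right, lor_sub_right, h.ρ_self, h.ρ_U_succ, h.ρ_U] at h1
  rw [eq_sub_of_add_eq' h1]
  ring

/-- Both points lie on the perpendicular to rod `m + 1` at its foot, on opposite sides of the foot,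
so their distance is the sum of the two parts. -/
lemma lor_succ_succ : lor (U m) (U (m + 2)) = -(ch m * ch (m + 1) + sh m * sh (m + 1)) := by
  rw [show m + 2 = (m + 1) + 1 from rfl, h.fwd (m + 1)]
  conv_lhs => rw [h.bwd m]
  simp only [lor_sub_left, lor_add_right, lor_smul_left, lor_smul_right, h.t_self, h.ρ_self,
    h.ρ_t, lor_comm (t (m + 1)) (ρ (m + 1))]
  ring

/-- Rods `m` and `m + 1` cross: `U (m + 1)` is on the positive side of rod `m`, while the foot `t (m
+ 1)`, lying between `U m` and `U (m + 2)`, is on the negative side. Inserted in `midpoint_sub`,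
this is the inequality. -/
lemma ch_lt (hn : 3 ≤ n) : ch m < C := by
  have hc := h.C_mul_ch_pos m
  have hch := h.one_lt_ch m
  have hs := h.sh_pos m
  have hs' := h.sh_pos (m + 1)
  have hC := h.one_lt
  have h2 : lor (ρ m) (U (m + 2)) < 0 := by
    have := h.sep m 2 (by norm_num) (by omega)
    norm_num at this
    exact this
  have hcomb : sh (m + 1) • U m + sh m • U (m + 2) =
      (sh (m + 1) * ch m + sh m * ch (m + 1)) • t (m + 1) := by
    rw [show m + 2 = (m + 1) + 1 from rfl, h.fwd (m + 1)]
    conv_lhs => rw [h.bwd m]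
    module
  have h3 := congrArg (lor (ρ m)) hcomb
  rw [lor_add_right, lor_smul_right, lor_smul_right, lor_smul_right, h.ρ_U] at h3
  have h4 : lor (ρ m) (t (m + 1)) < 0 := by
    have hp : 0 < sh (m + 1) * ch m + sh m * ch (m + 1) := by
      have := h.ch_pos m
      have := h.ch_pos (m + 1)
      positivity
    have : sh m * lor (ρ m) (U (m + 2)) < 0 := mul_neg_of_pos_of_neg hs h2
    by_contra hcon
    push Not at hcon
    nlinarith [mul_nonneg hp.le hcon]
  have h5 := congrArg (lor (ρ m)) (h.midpoint_sub m)
  rw [lor_smul_right, lor_add_right, lor_sub_right, lor_add_right, lor_add_right, h.ρ_self,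
    h.ρ_succ, h.ρ_U_succ, h.ρ_U, h.ρ_t] at h5
  have h6 : (C + 1) * (sh m / (1 + ch m)) * (sh m ^ 2 / (C * ch m - 1)) - sh m < 0 := by
    linarith
  have h7 : (C + 1) * (sh m / (1 + ch m)) * (sh m ^ 2 / (C * ch m - 1)) =
      sh m * ((C + 1) * (ch m - 1) / (C * ch m - 1)) := by
    have : (1 + ch m) ≠ 0 := by linarith
    have h8 : sh m ^ 2 = (ch m - 1) * (1 + ch m) := by linear_combination -h.ch_sq m
    rw [h8]
    field_simp
  have h8 : (C + 1) * (ch m - 1) / (C * ch m - 1) < 1 := by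
    rw [h7] at h6
    nlinarith
  rw [div_lt_one hc] at h8
  nlinarith

/-- These bounds say that the lines of consecutive rods meet or are asymptotic, so that one normal
can be turned into the other through unit spacelike vectors. -/
lemma abs_ρ_succ_le (hn : 3 ≤ n) : |lor (ρ m) (ρ (m + 1))| ≤ 1 ∧ lor (ρ m) (ρ (m + 1)) ≤ 0 := by
  have hc := h.C_mul_ch_pos m
  have h1 : 0 ≤ sh m ^ 2 / (C * ch m - 1) := by positivity
  have h2 : sh m ^ 2 / (C * ch m - 1) ≤ 1 := by
    rw [div_le_one hc]
    nlinarith [h.ch_lt m hn, h.ch_sq m, h.ch_pos m]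
  rw [h.ρ_succ, abs_le]
  refine ⟨⟨?_, ?_⟩, ?_⟩ <;> linarith

end Frame

end IsRodSystem

/-! ### Turning a rod until it is perpendicular to a chord -/

lemma exists_sign_change {a : ℕ → ℝ} {p n : ℕ} (hpn : p < n) (hp : 0 ≤ a p) (hn : a n ≤ 0) :
    ∃ j, p ≤ j ∧ j < n ∧ 0 ≤ a j ∧ a (j + 1) ≤ 0 := by
  induction n, hpn using Nat.le_induction with
  | base => exact ⟨p, le_rfl, Nat.lt_succ_self p, hp, hn⟩
  | succ m hm ih =>
    rcases le_total 0 (a m) with h0 | h0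
    · exact ⟨m, by omega, Nat.lt_succ_self m, h0, hn⟩
    · obtain ⟨j, h1, h2, h3⟩ := ih h0
      exact ⟨j, h1, by omega, h3⟩

lemma exists_normalized_weights {x y g : ℝ} (hx : 0 ≤ x) (hy : y ≤ 0) (hg : 0 ≤ g) :
    ∃ α β : ℝ, 0 ≤ α ∧ 0 ≤ β ∧ 0 < α + β ∧ α ^ 2 + β ^ 2 + 2 * α * β * g = 1 ∧
      α * x + β * y = 0 := by
  obtain ⟨α, β, hα, hβ, hs, h0⟩ : ∃ α β : ℝ, 0 ≤ α ∧ 0 ≤ β ∧ 0 < α + β ∧ α * x + β * y = 0 := by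
    by_cases h : x = 0
    · exact ⟨1, 0, by norm_num, le_rfl, by norm_num, by simp [h]⟩
    · have : 0 < x := lt_of_le_of_ne hx (Ne.symm h)
      exact ⟨-y, x, by linarith, hx, by linarith, by ring⟩
  have hq : 0 < α ^ 2 + β ^ 2 + 2 * α * β * g := by
    have : 0 ≤ 2 * α * β * g := by positivity
    nlinarith [sq_nonneg (α - β), mul_pos hs hs]
  have hr := Real.sqrt_pos.mpr hq
  have hr2 := Real.sq_sqrt hq.le
  set r := √(α ^ 2 + β ^ 2 + 2 * α * β * g)
  refine ⟨α / r, β / r, by positivity, by positivity, ?_, ?_, ?_⟩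
  · rw [← add_div]; positivity
  · field_simp
    linarith
  · field_simp
    linarith

namespace IsRodSystem

variable {n : ℕ} {C s : ℝ} {U t ρ : ℕ → Fin 3 → ℝ} {ch sh : ℕ → ℝ}

section Interpolation

variable (h : IsRodSystem n C s U t ρ ch sh)
include h

lemma sep_right {i m : ℕ} (him : i < m) (hm : m < i + n) :
    0 < (-1) ^ m * lor ((-1 : ℝ) ^ (i + 1) • ρ i) (U m) := by
  have h1 := h.sep i (m - i) (by omega) (by omega)
  obtain ⟨q, rfl⟩ := Nat.exists_eq_add_of_lt him
  rw [lor_smul_left]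
  have e : i + (i + q + 1 - i) = i + q + 1 := by omega
  have e2 : i + q + 1 - i = q + 1 := by omega
  rw [e, e2] at h1
  have e3 : (-1 : ℝ) ^ (i + q + 1) * ((-1) ^ (i + 1) * lor (ρ i) (U (i + q + 1))) =
      ((-1) ^ i) ^ 2 * ((-1) ^ (q + 1 + 1) * lor (ρ i) (U (i + q + 1))) := by ring
  rw [e3, ← pow_mul, mul_comm i 2, pow_mul]
  simpa using h1

/-- Periodicity moves `U m` to `U (m + n)`, beyond rod `i`; since `n` is odd, the sign is opposite
to that in `sep_right`. -/
lemma sep_left (hn : Odd n) {i m : ℕ} (hmi : m < i) (hi : i < m + n) :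
    0 < (-1) ^ (m + 1) * lor ((-1 : ℝ) ^ (i + 1) • ρ i) (U m) := by
  have h1 := h.sep i (m + n - i) (by omega) (by omega)
  rw [show i + (m + n - i) = m + n by omega, h.U_per] at h1
  rw [lor_smul_left, ← mul_assoc, ← pow_add]
  have e : (-1 : ℝ) ^ (m + 1 + (i + 1)) = (-1) ^ (m + n - i + 1) := by
    rcases Nat.even_or_odd (m + n - i + 1) with h2 | h2
    · have h3 : Even (m + 1 + (i + 1)) := by
        rw [Nat.even_iff] at *
        rw [Nat.odd_iff] at hn
        omega
      rw [h2.neg_one_pow, h3.neg_one_pow]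
    · have h3 : Odd (m + 1 + (i + 1)) := by
        rw [Nat.odd_iff] at *
        omega
      rw [h2.neg_one_pow, h3.neg_one_pow]
  rwa [e]

/-- When the rods from the `p`-th one to the `n`-th one (which is the first one) turn, at some
moment the line of a rod has a normal `Y` orthogonal to a given vector `N`. The numbers
`± lor (ρ m) Y` increase up to that moment and decrease afterwards. -/
lemma exists_interpolated_rod (hn : Odd n) (hn3 : 3 ≤ n) {p : ℕ} (hp : Odd p) (hpn : p < n)
    {N : Fin 3 → ℝ} (hN : 0 ≤ lor (ρ p) N) (hN' : lor (ρ n) N ≤ 0) :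
    ∃ (j : ℕ) (Y : Fin 3 → ℝ), p ≤ j ∧ j < n ∧ lor Y Y = 1 ∧ lor Y N = 0 ∧
      0 ≤ lor Y (U p) ∧ lor Y (U n) ≤ 0 ∧
      (-1) ^ (j + 1) * lor (ρ j) Y ≤ 1 ∧ (-1) ^ (j + 1 + 1) * lor (ρ (j + 1)) Y ≤ 1 ∧
      (∀ m, p ≤ m → m < j →
        (-1) ^ (m + 1) * lor (ρ m) Y < (-1) ^ (m + 1 + 1) * lor (ρ (m + 1)) Y) ∧
      (∀ m, j < m → m < n →
        (-1) ^ (m + 1 + 1) * lor (ρ (m + 1)) Y < (-1) ^ (m + 1) * lor (ρ m) Y) := by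
  -- The alternating sign makes the normals turn coherently. It is `+1` at both `p` and `n`, as
  -- these are odd.
  obtain ⟨j, hpj, hjn, hj, hj'⟩ := exists_sign_change
    (a := fun m => lor ((-1 : ℝ) ^ (m + 1) • ρ m) N) hpn
    (by simpa [hp.add_one.neg_one_pow] using hN) (by simpa [hn.add_one.neg_one_pow] using hN')
  have hp1 : 1 ≤ p := hp.pos
  have hg := h.abs_ρ_succ_le j hn3
  have hgl := (abs_le.mp hg.1).1
  obtain ⟨α, β, hα, hβ, hs, hq, h0⟩ := exists_normalized_weights (g := -lor (ρ j) (ρ (j + 1)))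
    hj hj' (by linarith [hg.2])
  set g := lor (ρ j) (ρ (j + 1)) with hgdef
  have hsq : ∀ m : ℕ, ((-1 : ℝ) ^ m) ^ 2 = 1 := fun m => by
    rw [← pow_mul, mul_comm, pow_mul]; norm_num
  set Y := α • ((-1 : ℝ) ^ (j + 1) • ρ j) + β • ((-1 : ℝ) ^ (j + 1 + 1) • ρ (j + 1)) with hY
  have bj : (-1) ^ (j + 1) * lor (ρ j) Y = α - β * g := by
    simp only [hY, lor_add_right, lor_smul_right, h.ρ_self, ← hgdef]
    linear_combination (α - β * g) * hsq (j + 1)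
  have bj' : (-1) ^ (j + 1 + 1) * lor (ρ (j + 1)) Y = β - α * g := by
    simp only [hY, lor_add_right, lor_smul_right, h.ρ_self, lor_comm (ρ (j + 1)) (ρ j), ← hgdef]
    linear_combination (β - α * g) * hsq (j + 1)
  have hg1 : 0 ≤ 1 - g ^ 2 := by nlinarith [hg.2]
  have lowW : ∀ m, p ≤ m → m ≤ j → 0 ≤ (-1) ^ (m + 1) * lor Y (U m) ∧
      (m < j → 0 < (-1) ^ (m + 1) * lor Y (U m)) := by
    intro m hm1 hm2
    have e : (-1) ^ (m + 1) * lor Y (U m) =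
        α * ((-1) ^ (m + 1) * lor ((-1 : ℝ) ^ (j + 1) • ρ j) (U m)) +
        β * ((-1) ^ (m + 1) * lor ((-1 : ℝ) ^ (j + 1 + 1) • ρ (j + 1)) (U m)) := by
      simp only [hY, lor_add_left, lor_smul_left]; ring
    have h2 := h.sep_left hn (i := j + 1) (m := m) (by omega) (by omega)
    rw [e]
    rcases hm2.eq_or_lt with rfl | hm3
    · refine ⟨?_, fun h3 => absurd h3 (lt_irrefl _)⟩
      rw [lor_smul_left _ (U m) , h.ρ_U]
      have := mul_nonneg hβ h2.le
      simpa using this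
    · have h1 := h.sep_left hn hm3 (by omega)
      have h3 : 0 < α * ((-1) ^ (m + 1) * lor ((-1 : ℝ) ^ (j + 1) • ρ j) (U m)) +
          β * ((-1) ^ (m + 1) * lor ((-1 : ℝ) ^ (j + 1 + 1) • ρ (j + 1)) (U m)) := by
        rcases hα.eq_or_lt with h4 | h4
        · have h5 : 0 < β := by linarith
          rw [← h4]
          have := mul_pos h5 h2
          linarith
        · have := mul_pos h4 h1
          have := mul_nonneg hβ h2.le
          linarith
      exact ⟨h3.le, fun _ => h3⟩
  have highW : ∀ m, j + 1 ≤ m → m ≤ n → 0 ≤ (-1) ^ m * lor Y (U m) ∧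
      (j + 1 < m → 0 < (-1) ^ m * lor Y (U m)) := by
    intro m hm1 hm2
    have e : (-1) ^ m * lor Y (U m) =
        α * ((-1) ^ m * lor ((-1 : ℝ) ^ (j + 1) • ρ j) (U m)) +
        β * ((-1) ^ m * lor ((-1 : ℝ) ^ (j + 1 + 1) • ρ (j + 1)) (U m)) := by
      simp only [hY, lor_add_left, lor_smul_left]; ring
    have h2 := h.sep_right (i := j) (m := m) (by omega) (by omega)
    rw [e]
    rcases hm1.eq_or_lt with rfl | hm3
    · refine ⟨?_, fun h3 => absurd h3 (lt_irrefl _)⟩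
      rw [lor_smul_left _ (U (j + 1)) _ , lor_smul_left (ρ (j + 1)), h.ρ_U]
      rw [lor_smul_left] at h2
      have := mul_nonneg hα h2.le
      simpa using this
    · have h1 := h.sep_right hm3 (by omega)
      have h3 : 0 < α * ((-1) ^ m * lor ((-1 : ℝ) ^ (j + 1) • ρ j) (U m)) +
          β * ((-1) ^ m * lor ((-1 : ℝ) ^ (j + 1 + 1) • ρ (j + 1)) (U m)) := by
        rcases hα.eq_or_lt with h4 | h4
        · have h5 : 0 < β := by linarith
          rw [← h4]
          have := mul_pos h5 h1
          linarith
        · have := mul_pos h4 h2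
          have := mul_nonneg hβ h1.le
          linarith
      exact ⟨h3.le, fun _ => h3⟩
  -- By `ρ_add`, the differences of `b` are governed by the signs of `lor Y (U m)`, which the
  -- separation property supplies on both sides of `j`.
  have step : ∀ m, (-1) ^ (m + 1) * lor (ρ m) Y - (-1) ^ (m + 1 + 1) * lor (ρ (m + 1)) Y =
      sh m / (C * ch m - 1) *
        ((-1) ^ (m + 1) * lor Y (U (m + 1)) - (-1) ^ (m + 1) * lor Y (U m)) := by
    intro m
    have h1 := congrArg (lor Y) (h.ρ_add m)
    rw [lor_add_right, lor_smul_right, lor_sub_right] at h1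
    rw [pow_succ _ (m + 1), lor_comm (ρ m), lor_comm (ρ (m + 1))]
    linear_combination (-1) ^ (m + 1) * h1
  have hν : ∀ m, 0 < sh m / (C * ch m - 1) := fun m =>
    div_pos (h.sh_pos m) (h.C_mul_ch_pos m)
  refine ⟨j, Y, hpj, hjn, ?_, ?_, ?_, ?_, ?_, ?_, ?_, ?_⟩
  · simp only [hY, lor_add_left, lor_add_right, lor_smul_left, lor_smul_right, h.ρ_self,
      lor_comm (ρ (j + 1)) (ρ j), ← hgdef]
    linear_combination (α ^ 2 + β ^ 2 - 2 * α * β * g) * hsq (j + 1) + hq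
  · rw [hY, lor_add_left, lor_smul_left _ _ α, lor_smul_left _ _ β]
    exact h0
  · have := (lowW p le_rfl hpj).1
    rwa [hp.add_one.neg_one_pow, one_mul] at this
  · have := (highW n hjn le_rfl).1
    rw [hn.neg_one_pow] at this
    linarith
  -- The normalization of the weights gives `(α - β g)² = 1 - β² (1 - g²)`.
  · rw [bj]
    nlinarith [mul_nonneg (sq_nonneg β) hg1, sq_nonneg (α - β * g - 1)]
  · rw [bj']
    nlinarith [mul_nonneg (sq_nonneg α) hg1, sq_nonneg (β - α * g - 1)]
  · intro m h1 h2
    have h3 := (lowW m h1 h2.le).2 h2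
    have h4 := (lowW (m + 1) (by omega) h2).1
    have h5 := step m
    rw [pow_succ _ (m + 1)] at h4
    have := mul_pos (hν m) (show 0 < (-1) ^ (m + 1) * lor Y (U m) -
      (-1) ^ (m + 1) * lor Y (U (m + 1)) by linarith)
    linarith
  · intro m h1 h2
    have h3 := (highW m h1 h2.le).1
    have h4 := (highW (m + 1) (by omega) h2).2 (by omega)
    have h5 := step m
    have h6 : (-1 : ℝ) ^ (m + 1) * lor Y (U m) = -((-1) ^ m * lor Y (U m)) := by ring
    have := mul_pos (hν m) (show 0 < (-1) ^ (m + 1) * lor Y (U (m + 1)) -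
      (-1) ^ (m + 1) * lor Y (U m) by linarith)
    linarith

end Interpolation

end IsRodSystem

/-! ### The alternating sum and inequalities between real numbers -/

lemma alternating_term_le (b : ℕ → ℝ) {T τ : ℝ} {m : ℕ} (hT : 0 ≤ T) (hτ : T ≤ τ) :
    (-1) ^ m * T * (b m - b (m + 1)) ≤ τ * |b m - b (m + 1)| :=
  calc (-1) ^ m * T * (b m - b (m + 1)) ≤ |(-1) ^ m * T * (b m - b (m + 1))| := le_abs_self _
    _ = T * |b m - b (m + 1)| := by
      rw [abs_mul, abs_mul, abs_pow, abs_neg, abs_one, one_pow, one_mul, abs_of_nonneg hT]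
    _ ≤ τ * |b m - b (m + 1)| := mul_le_mul_of_nonneg_right hτ (abs_nonneg _)

/-- Abel-type estimate for a sequence which increases up to the index `j` and decreases after the
index `j + 1`. -/
lemma alternating_sum_le {b T : ℕ → ℝ} {p j n : ℕ} {τ : ℝ} (hpj : p ≤ j) (hjn : j < n)
    (hj : b j ≤ 1) (hj' : b (j + 1) ≤ 1) (hup : ∀ m, p ≤ m → m < j → b m < b (m + 1))
    (hdown : ∀ m, j < m → m < n → b (m + 1) < b m) (hT : ∀ m, 0 ≤ T m) (hτ : ∀ m, T m ≤ τ) :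
    ∑ m ∈ Finset.Ico p n, (-1) ^ m * T m * (b m - b (m + 1)) ≤
        ∑ m ∈ Finset.Ico p n, τ * |b m - b (m + 1)| ∧
      ∑ m ∈ Finset.Ico p n, |b m - b (m + 1)| ≤ 2 - b p - b n := by
  constructor
  · exact Finset.sum_le_sum fun m _ => alternating_term_le b (hT m) (hτ m)
  · have h1 : ∑ m ∈ Finset.Ico p j, |b m - b (m + 1)| = b j - b p := by
      rw [← Finset.sum_Ico_sub b hpj]
      refine Finset.sum_congr rfl fun m hm => ?_
      rw [Finset.mem_Ico] at hm
      rw [abs_sub_comm, abs_of_pos (sub_pos.mpr (hup m hm.1 hm.2))]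
    have h2 : ∑ m ∈ Finset.Ico (j + 1) n, |b m - b (m + 1)| = b (j + 1) - b n := by
      rw [← neg_sub (b n), ← Finset.sum_Ico_sub b hjn, ← Finset.sum_neg_distrib]
      refine Finset.sum_congr rfl fun m hm => ?_
      rw [Finset.mem_Ico] at hm
      rw [abs_of_pos (sub_pos.mpr (hdown m hm.1 hm.2)), neg_sub]
    rw [← Finset.sum_Ico_consecutive _ hpj hjn.le, Finset.sum_eq_sum_Ico_succ_bot hjn, h1, h2]
    -- The total variation is `2 max (b j, b (j + 1)) - b p - b n`, whichever of the two middle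
    -- values is larger.
    rcases abs_cases (b j - b (j + 1)) with ⟨h3, _⟩ | ⟨h3, _⟩ <;> rw [h3] <;> linarith

section RealLemmas

/-- `tanh (x / 2)` increases with `cosh x`. -/
lemma half_tanh_le {c d σ δ : ℝ} (hc : 1 ≤ c) (hcd : c ≤ d) (hδ : 0 ≤ δ)
    (h1 : c ^ 2 = σ ^ 2 + 1) (h2 : d ^ 2 = δ ^ 2 + 1) : σ / (1 + c) ≤ δ / (1 + d) := by
  rw [div_le_div_iff₀ (by linarith) (by linarith)]
  apply le_of_sq_le_sq _ (by positivity)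
  have e1 : σ ^ 2 = (c - 1) * (c + 1) := by linarith
  have e2 : δ ^ 2 = (d - 1) * (d + 1) := by linarith
  rw [mul_pow, mul_pow, e1, e2]
  have : 0 ≤ (c + 1) * (d + 1) * (2 * (d - c)) := by
    have : 0 ≤ d - c := by linarith
    have : 0 ≤ c + 1 := by linarith
    have : 0 ≤ d + 1 := by linarith
    positivity
  nlinarith

lemma half_tanh_lt {c d σ δ : ℝ} (hc : 1 ≤ c) (hcd : c < d) (hδ : 0 ≤ δ)
    (h1 : c ^ 2 = σ ^ 2 + 1) (h2 : d ^ 2 = δ ^ 2 + 1) : σ / (1 + c) < δ / (1 + d) := by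
  refine lt_of_le_of_ne (half_tanh_le hc hcd.le hδ h1 h2) fun he => ?_
  rw [div_eq_div_iff (by linarith) (by linarith)] at he
  have e1 : σ ^ 2 = (c - 1) * (c + 1) := by linarith
  have e2 : δ ^ 2 = (d - 1) * (d + 1) := by linarith
  have e3 := congrArg (· ^ 2) he
  simp only [mul_pow, e1, e2] at e3
  have : 0 < (c + 1) * (d + 1) * (2 * (d - c)) := by
    have : 0 < d - c := by linarith
    have : 0 < c + 1 := by linarith
    have : 0 < d + 1 := by linarith
    positivity
  nlinarith

/-- This rests on `(E + 1) (g + h)² = 2 (g² + h² + 2 E g h) + (E - 1) (g - h)²`. -/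
lemma two_mul_le_sq_add {E g h : ℝ} (hE : 1 < E)
    (hgh : g ^ 2 + h ^ 2 + 2 * E * g * h = E ^ 2 - 1) : 2 * (E - 1) ≤ (g + h) ^ 2 := by
  have h1 : (E + 1) * (2 * (E - 1)) ≤ (E + 1) * (g + h) ^ 2 := by
    nlinarith [mul_nonneg (show 0 ≤ E - 1 by linarith) (sq_nonneg (g - h))]
  exact le_of_mul_le_mul_left h1 (by linarith)

/-- The estimate of the angle between a rod and a chord which is at least as long as the side of
the regular triangle. -/
lemma angle_estimate {C s c σ E S x y : ℝ} (hC : 1 < C) (hs : 0 < s) (hsq : s ^ 2 = C ^ 2 - 1)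
    (hc : 1 < c) (hcC : 2 * c ^ 2 = C * c + 1) (hσ : 0 < σ) (hσc : c ^ 2 = σ ^ 2 + 1)
    (hE : C * c ≤ E) (hS : 0 < S) (hES : S ^ 2 = E ^ 2 - 1) (hy : 0 < y)
    (hxy : x ^ 2 + y ^ 2 = 1) (hx : C * S * x ≤ s * E) :
    s * x ≤ (C + 1) * (σ / (1 + c)) * (1 + y) := by
  rcases le_or_gt x 0 with hx0 | hx0
  · have h1 : s * x ≤ 0 := mul_nonpos_of_nonneg_of_nonpos hs.le hx0
    have h2 : 0 ≤ (C + 1) * (σ / (1 + c)) * (1 + y) := by positivity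
    linarith
  have hE0 : 0 < E := lt_of_lt_of_le (by positivity) hE
  have hE2 : C ^ 2 * c ^ 2 ≤ E ^ 2 := by
    rw [← mul_pow]; exact pow_le_pow_left₀ (by positivity) hE 2
  have h2c : C < 2 * c := by nlinarith
  have h1 : C ^ 2 * S ^ 2 * x ^ 2 ≤ s ^ 2 * E ^ 2 := by
    rw [← mul_pow, ← mul_pow, ← mul_pow]; exact pow_le_pow_left₀ (by positivity) hx 2
  have h2 : s ^ 2 * E ^ 2 * (4 * c ^ 2) ≤ (4 * c ^ 2 - 1) * (C ^ 2 * S ^ 2) := by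
    have h3 : C ^ 2 * c ^ 2 * (4 * c ^ 2 - C ^ 2) ≤ E ^ 2 * (4 * c ^ 2 - C ^ 2) :=
      mul_le_mul_of_nonneg_right hE2 (by nlinarith)
    have h4 : C ^ 2 * c ^ 2 * (4 * c ^ 2 - C ^ 2) = (4 * c ^ 2 - 1) * C ^ 2 := by
      linear_combination (C ^ 2 * (2 * c ^ 2 + C * c - 1)) * hcC
    rw [hsq, hES]
    nlinarith
  have hCS : 0 < C ^ 2 * S ^ 2 := by positivity
  have h3 : x ^ 2 * (4 * c ^ 2) ≤ 4 * c ^ 2 - 1 := by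
    have : C ^ 2 * S ^ 2 * (x ^ 2 * (4 * c ^ 2)) ≤ C ^ 2 * S ^ 2 * (4 * c ^ 2 - 1) := by
      nlinarith [sq_nonneg c]
    exact le_of_mul_le_mul_left this hCS
  -- In the regular triangle `1 / (2 c)` is the sine of half an angle.
  have h4 : 1 ≤ 2 * c * y := by
    have : (1 : ℝ) ^ 2 ≤ (2 * c * y) ^ 2 := by nlinarith
    exact le_of_sq_le_sq this (by positivity)
  have e1 : σ ^ 2 = (c - 1) * (1 + c) := by linarith
  -- Up to a factor `1 + y`, this is the square of the goal. It is linear in `y`, with equality for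
  -- the regular triangle, where `2 c y = 1`.
  have hq : (1 - y) * s ^ 2 * (1 + c) ^ 2 ≤ (C + 1) ^ 2 * σ ^ 2 * (1 + y) := by
    rw [e1, hsq]
    have h5 : 0 ≤ (C + 1) * (1 + c) * ((C + 1) * (c - 1) * (1 + y) -
        (1 - y) * (C - 1) * (1 + c)) := by
      have h6 : c * ((C + 1) * (c - 1) * (1 + y) - (1 - y) * (C - 1) * (1 + c)) =
          2 * (c ^ 2 - 1) * (2 * c * y - 1) := by
        linear_combination (2 - 2 * c * y) * hcC
      have h7 : 0 ≤ c * ((C + 1) * (c - 1) * (1 + y) - (1 - y) * (C - 1) * (1 + c)) := by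
        rw [h6]
        have : 0 ≤ c ^ 2 - 1 := by nlinarith
        have : 0 ≤ 2 * c * y - 1 := by linarith
        positivity
      have h8 := nonneg_of_mul_nonneg_right h7 (by linarith)
      positivity
    nlinarith
  have h9 : (C + 1) * (σ / (1 + c)) * (1 + y) = ((C + 1) * σ * (1 + y)) / (1 + c) := by
    field_simp
  rw [h9, le_div_iff₀ (by linarith)]
  apply le_of_sq_le_sq _ (by positivity)
  have h10 : x ^ 2 = (1 - y) * (1 + y) := by linarith
  calc (s * x * (1 + c)) ^ 2 = (1 + y) * ((1 - y) * s ^ 2 * (1 + c) ^ 2) := by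
        rw [mul_pow, mul_pow, h10]; ring
    _ ≤ (1 + y) * ((C + 1) ^ 2 * σ ^ 2 * (1 + y)) :=
        mul_le_mul_of_nonneg_left hq (by linarith)
    _ = _ := by ring

/-- Let `A` and `B` be the hyperbolic cosine and sine of half the chord. The right side is `(g + h)
(B - τ A) / B` with `τ = σ / (1 + c)`; now `g + h ≥ 2 B`, and `τ (1 + A) ≤ B` because `c ≤ A`. -/
lemma chord_estimate {c σ E S g h : ℝ} (hc : 1 < c) (hσ : 0 < σ) (hσc : c ^ 2 = σ ^ 2 + 1)
    (hE : 2 * c ^ 2 - 1 ≤ E) (hS : 0 < S) (hES : S ^ 2 = E ^ 2 - 1) (hg : 0 ≤ g) (hh : 0 ≤ h)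
    (hgh : g ^ 2 + h ^ 2 + 2 * E * g * h = E ^ 2 - 1) :
    2 * (σ / (1 + c)) ≤ g + h - (σ / (1 + c)) * ((h + E * g) / S + (g + E * h) / S) := by
  have hE1 : 1 < E := by nlinarith
  have hA2 := Real.sq_sqrt (show 0 ≤ (E + 1) / 2 by linarith)
  have hB2 := Real.sq_sqrt (show 0 ≤ (E - 1) / 2 by linarith)
  have hA := Real.sqrt_pos.mpr (show 0 < (E + 1) / 2 by linarith)
  have hB := Real.sqrt_pos.mpr (show 0 < (E - 1) / 2 by linarith)
  set A := √((E + 1) / 2)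
  set B := √((E - 1) / 2)
  have hSAB : S = 2 * A * B := by
    have h1 : S ^ 2 = (2 * A * B) ^ 2 := by
      rw [mul_pow, mul_pow, hA2, hB2, hES]; ring
    exact (sq_eq_sq₀ hS.le (by positivity)).mp h1
  have hcA : c ≤ A := le_of_sq_le_sq (by rw [hA2]; linarith) hA.le
  have hτ := half_tanh_le hc.le hcA hB.le hσc (by rw [hA2, hB2]; ring)
  set τ := σ / (1 + c)
  rw [le_div_iff₀ (by linarith)] at hτ
  have hgB : 2 * B ≤ g + h := by
    refine le_of_sq_le_sq ?_ (by positivity)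
    have := two_mul_le_sq_add hE1 hgh
    rw [mul_pow, hB2]; linarith
  have e : (h + E * g) / S + (g + E * h) / S = (g + h) * (A / B) := by
    have hE' : E = 2 * A ^ 2 - 1 := by linarith
    rw [hSAB, hE']
    field_simp
    ring
  rw [e]
  have hτ0 : 0 < τ := by positivity
  have h1 : 0 ≤ B - τ * A := by nlinarith
  have h2 : g + h - τ * ((g + h) * (A / B)) = (g + h) * ((B - τ * A) / B) := by
    field_simp
  rw [h2]
  calc 2 * τ ≤ 2 * (B - τ * A) := by linarith
    _ = 2 * B * ((B - τ * A) / B) := by field_simp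
    _ ≤ _ := mul_le_mul_of_nonneg_right hgB (by positivity)

end RealLemmas

/-! ### The displacement of the midpoints and the chords of a chain -/

/-- A unit vector in the plane of two points of the hyperboloid, in terms of its products with
them. -/
lemma eq_comb_of_lor_lcross_eq_zero {x y Y : Fin 3 → ℝ} {E : ℝ} (hE : 1 < E)
    (hx : lor x x = -1) (hy : lor y y = -1) (hxy : lor x y = -E) (hY : lor Y (lcross x y) = 0) :
    Y = ((lor Y x - E * lor Y y) / (E ^ 2 - 1)) • x +
      ((lor Y y - E * lor Y x) / (E ^ 2 - 1)) • y := by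
  have hyx : lor y x = -E := by rw [lor_comm, hxy]
  have hE2 : 0 < E ^ 2 - 1 := by nlinarith
  rw [← sub_eq_zero]
  have hE2' := hE2.ne'
  apply eq_zero_of_orthogonal (a := x) (b := y)
  · rw [lor_lcross_lcross, hx, hy, hxy, hyx]
    nlinarith
  · simp only [lor_sub_left, lor_add_left, lor_smul_left, hx, hyx]
    field_simp
    ring
  · simp only [lor_sub_left, lor_add_left, lor_smul_left, hxy, hy]
    field_simp
    ring
  · rw [lor_sub_left, lor_add_left, lor_smul_left, lor_smul_left, lor_comm x, lor_lcross_left,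
      lor_comm y, lor_lcross_right, hY]
    ring

/-- The Gram determinant of the coplanar vectors `x`, `y`, `Y` vanishes. -/
lemma lor_sq_relation {x y Y : Fin 3 → ℝ} {E : ℝ} (hE : 1 < E)
    (hx : lor x x = -1) (hy : lor y y = -1) (hxy : lor x y = -E) (hY : lor Y (lcross x y) = 0)
    (hYY : lor Y Y = 1) :
    (-lor Y x) ^ 2 + lor Y y ^ 2 + 2 * E * (-lor Y x) * lor Y y = E ^ 2 - 1 := by
  have h1 := congrArg (lor Y) (eq_comb_of_lor_lcross_eq_zero hE hx hy hxy hY)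
  have hE2 : E ^ 2 - 1 ≠ 0 := by nlinarith
  rw [lor_add_right, lor_smul_right, lor_smul_right, hYY] at h1
  field_simp at h1
  linarith

namespace IsRodSystem

variable {n : ℕ} {C s : ℝ} {U t ρ : ℕ → Fin 3 → ℝ} {ch sh : ℕ → ℝ}
  (h : IsRodSystem n C s U t ρ ch sh)
include h

lemma displacement_eq {p : ℕ} (hpn : p ≤ n) (Y : Fin 3 → ℝ) :
    lor (U p + t p - (U n + t n)) Y = (C + 1) * ∑ m ∈ Finset.Ico p n,
      (-1) ^ m * (sh m / (1 + ch m)) *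
        ((-1) ^ (m + 1) * lor (ρ m) Y - (-1) ^ (m + 1 + 1) * lor (ρ (m + 1)) Y) := by
  have h1 := Finset.sum_Ico_sub (fun m => lor (U m + t m) Y) hpn
  have h2 : lor (U p + t p - (U n + t n)) Y = -∑ m ∈ Finset.Ico p n,
      (lor (U (m + 1) + t (m + 1)) Y - lor (U m + t m) Y) := by
    rw [h1, lor_sub_left]; ring
  rw [h2, ← Finset.sum_neg_distrib, Finset.mul_sum]
  refine Finset.sum_congr rfl fun m _ => ?_
  have hsq : ((-1 : ℝ) ^ m) ^ 2 = 1 := by rw [← pow_mul, mul_comm, pow_mul]; norm_num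
  rw [← lor_sub_left, ← h.midpoint_sub m, lor_smul_left, lor_add_left]
  linear_combination ((C + 1) * (sh m / (1 + ch m)) * (lor (ρ m) Y + lor (ρ (m + 1)) Y)) * hsq

/-- The midpoints of the rods at two of the points `U` are displaced, in the direction of the
chord of these points, by at most a multiple of the largest value of `sh / (1 + ch)`. -/
lemma displacement_le (hn : Odd n) (hn3 : 3 ≤ n) {p : ℕ} (hp : Odd p) (hpn : p < n) {E τ : ℝ}
    (hE : lor (U 0) (U p) = -E) (h0 : -lor (t 0) (U p) ≤ C * E) (h0' : -lor (t p) (U 0) ≤ C * E)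
    (hτ : ∀ m, sh m / (1 + ch m) ≤ τ) :
    ∃ (Y : Fin 3 → ℝ) (V : ℝ), lor Y Y = 1 ∧ lor Y (lcross (U 0) (U p)) = 0 ∧
      0 ≤ lor Y (U p) ∧ lor Y (U 0) ≤ 0 ∧ 0 < V ∧ V ≤ 2 - lor (ρ p) Y - lor (ρ 0) Y ∧
      lor (U p + t p - (U 0 + t 0)) Y ≤ (C + 1) * (τ * V) ∧
      (p = 1 → 5 ≤ n → lor (U p + t p - (U 0 + t 0)) Y < (C + 1) * (τ * V)) := by
  obtain ⟨ε, hε, hρ⟩ := h.ρ_eq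
  have hU := h.U_per 0
  have ht := h.t_per 0
  have hρn := h.ρ_per 0
  rw [zero_add] at hU ht hρn
  have hs := h.s_pos
  have hE' : lor (U p) (U 0) = -E := by rw [lor_comm, hE]
  -- The vector `-ε • lcross (U 0) (U p)` is normal to the chord. By the law of cosines the two
  -- products are, up to sign and a nonnegative factor, the cosines of the angles between the chord
  -- and the rods at its ends; `h0` and `h0'` say that these are not obtuse.
  have e1 : lor (ρ p) (-ε • lcross (U 0) (U p)) = (C * E + lor (t p) (U 0)) / s := by
    rw [lor_smul_right, hρ, lor_smul_left, lor_lcross_lcross, h.U_self, hE', h.t_U]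
    field_simp
    linear_combination (C * E + lor (t p) (U 0)) * hε
  have e2 : lor (ρ n) (-ε • lcross (U 0) (U p)) = -((C * E + lor (t 0) (U p)) / s) := by
    rw [hρn, lor_smul_right, hρ, lor_smul_left, lor_lcross_lcross, h.U_self, hE, h.t_U]
    field_simp
    linear_combination (-(C * E + lor (t 0) (U p))) * hε
  obtain ⟨j, Y, hpj, hjn, hYY, hYN, hYp, hYn, bj, bj', hup, hdown⟩ :=
    h.exists_interpolated_rod hn hn3 hp hpn (N := -ε • lcross (U 0) (U p))
      (by rw [e1]; exact div_nonneg (by linarith) hs.le)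
      (by rw [e2, neg_nonpos]; exact div_nonneg (by linarith) hs.le)
  have hε0 : -ε ≠ 0 := by rintro h1; rw [neg_eq_zero.mp h1] at hε; norm_num at hε
  set b : ℕ → ℝ := fun m => (-1) ^ (m + 1) * lor (ρ m) Y with hb
  set T : ℕ → ℝ := fun m => sh m / (1 + ch m) with hTdef
  have hT : ∀ m, 0 < T m := fun m => by
    have := h.ch_pos m
    have := h.sh_pos m
    simp only [hTdef]; positivity
  have hτ0 : 0 < τ := (hT 0).trans_le (hτ 0)
  have hA := alternating_sum_le (b := b) (T := T) hpj hjn bj bj' hup hdown (fun m => (hT m).le) hτ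
  have hdisp := h.displacement_eq hpn.le Y
  rw [hU, ht] at hdisp
  have hC : 0 < C + 1 := by linarith [h.one_lt]
  rw [← Finset.mul_sum] at hA
  refine ⟨Y, ∑ m ∈ Finset.Ico p n, |b m - b (m + 1)|, hYY, ?_, hYp, by rwa [hU] at hYn, ?_, ?_, ?_,
    ?_⟩
  · rw [lor_smul_right] at hYN
    exact (mul_eq_zero.mp hYN).resolve_left hε0
  -- Some step is strictly monotone: the last one if `j = p`, as parity gives `p < n - 1`, and
  -- otherwise the first one.
  · rcases hpj.eq_or_lt with rfl | hpj'
    · have hlt : p < n - 1 := by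
        rw [Nat.odd_iff] at hn hp
        omega
      refine Finset.sum_pos' (fun _ _ => abs_nonneg _) ⟨n - 1, ?_, ?_⟩
      · rw [Finset.mem_Ico]; omega
      · exact abs_pos.mpr (sub_pos.mpr (hdown (n - 1) hlt (by omega))).ne'
    · refine Finset.sum_pos' (fun _ _ => abs_nonneg _) ⟨p, ?_, ?_⟩
      · rw [Finset.mem_Ico]; omega
      · exact abs_pos.mpr (sub_neg.mpr (hup p le_rfl hpj')).ne
  · have := hA.2
    simp only [hb, hp.add_one.neg_one_pow, hn.add_one.neg_one_pow, hρn, one_mul] at this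
    exact this
  · rw [hdisp]
    exact mul_le_mul_of_nonneg_left hA.1 hC.le
  -- A term whose sign makes it negative gives strictness: index 3 if `b` already decreases there,
  -- and index 2 otherwise.
  · rintro rfl hn5
    rw [hdisp]
    refine mul_lt_mul_of_pos_left ?_ hC
    rw [Finset.mul_sum]
    refine Finset.sum_lt_sum (fun m _ => alternating_term_le b (hT m).le (hτ m)) ?_
    rcases le_or_gt j 2 with hj | hj
    · refine ⟨3, by rw [Finset.mem_Ico]; omega, ?_⟩
      have h3 := hdown 3 (by omega) (by omega)
      have h4 : 0 < b 3 - b (3 + 1) := sub_pos.mpr h3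
      have h5 : 0 < T 3 * (b 3 - b (3 + 1)) := mul_pos (hT 3) h4
      have h6 : 0 ≤ τ * |b 3 - b (3 + 1)| := by positivity
      have h7 : (-1 : ℝ) ^ 3 * T 3 * (b 3 - b (3 + 1)) = -(T 3 * (b 3 - b (3 + 1))) := by ring
      rw [h7]; linarith
    · refine ⟨2, by rw [Finset.mem_Ico]; omega, ?_⟩
      have h3 := hup 2 (by omega) hj
      have h4 : 0 < b (2 + 1) - b 2 := sub_pos.mpr h3
      have h5 : 0 < T 2 * (b (2 + 1) - b 2) := mul_pos (hT 2) h4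
      have h6 : 0 ≤ τ * |b 2 - b (2 + 1)| := by positivity
      have h7 : (-1 : ℝ) ^ 2 * T 2 * (b 2 - b (2 + 1)) = -(T 2 * (b (2 + 1) - b 2)) := by ring
      rw [h7]; linarith

/-- The largest of the numbers `ch m` is at most that of the regular triangle. -/
lemma two_mul_ch_sq_le (hn : Odd n) (hn3 : 3 ≤ n) (hmax : ∀ m, ch m ≤ ch 0) :
    2 * ch 0 ^ 2 ≤ C * ch 0 + 1 ∧ (5 ≤ n → 2 * ch 0 ^ 2 < C * ch 0 + 1) := by
  have hC := h.one_lt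
  have hch := h.one_lt_ch 0
  have hsh := h.sh_pos 0
  have hE1 : 1 < C * ch 0 := by nlinarith
  have hτ : ∀ m, sh m / (1 + ch m) ≤ sh 0 / (1 + ch 0) := fun m =>
    half_tanh_le (h.one_lt_ch m).le (hmax m) hsh.le (h.ch_sq m) (h.ch_sq 0)
  obtain ⟨Y, V, hYY, hYN, hY1, hY0, -, hV, hle, hlt⟩ := h.displacement_le hn hn3 odd_one
    (by omega) (h.U_succ 0) (by rw [← zero_add 1, h.t_U_succ 0]; nlinarith)
    (by rw [← zero_add 1, h.t_succ_U 0]; nlinarith) hτ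
  have hmid := h.midpoint_sub 0
  rw [zero_add] at hmid
  rw [← hmid, lor_smul_left] at hle hlt
  have hT : 0 < sh 0 / (1 + ch 0) := by positivity
  set T := sh 0 / (1 + ch 0)
  have hCT : 0 < (C + 1) * T := by positivity
  have hadd := congrArg (fun f => lor f Y) (h.ρ_add 0)
  simp only [zero_add, lor_smul_left, lor_sub_left] at hadd
  rw [lor_comm (U 1), lor_comm (U 0)] at hadd
  have hrel := lor_sq_relation hE1 (h.U_self 0) (h.U_self 1) (h.U_succ 0) hYN hYY
  have hgh := two_mul_le_sq_add hE1 hrel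
  have hν : 0 < sh 0 / (C * ch 0 - 1) := div_pos hsh (h.C_mul_ch_pos 0)
  set ν := sh 0 / (C * ch 0 - 1) with hνdef
  set q := lor (ρ 0 + ρ 1) Y with hq
  have hq' : q = ν * (-lor Y (U 0) + lor Y (U 1)) := by rw [hadd]; ring
  have hq0 : 0 ≤ q := by
    rw [hq']
    have : 0 ≤ -lor Y (U 0) + lor Y (U 1) := by linarith
    positivity
  have hqq : q = lor (ρ 0) Y + lor (ρ 1) Y := lor_add_left _ _ _
  have hνE : ν * (C * ch 0 - 1) = sh 0 := by
    rw [hνdef, div_mul_cancel₀ _ (h.C_mul_ch_pos 0).ne']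
  -- With `E = C ch 0` and `q = ν (g + h)`, this is `2 (E - 1) ≤ (g + h)²` multiplied by `ν² (E -
  -- 1)`. The displacement bound reads `q ≤ V ≤ 2 - q`, so `q ≤ 1`.
  have key : 2 * sh 0 ^ 2 ≤ q ^ 2 * (C * ch 0 - 1) := by
    rw [hq', mul_pow, ← hνE]
    have := mul_le_mul_of_nonneg_left hgh
      (mul_nonneg (sq_nonneg ν) (h.C_mul_ch_pos 0).le)
    nlinarith
  have hcs := h.ch_sq 0
  have hpos := h.C_mul_ch_pos 0
  constructor
  · have h1 : q ≤ V := by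
      have : (C + 1) * T * q ≤ (C + 1) * T * V := by linarith
      exact le_of_mul_le_mul_left this hCT
    have h2 : q ≤ 1 := by linarith
    have : q ^ 2 ≤ 1 := by nlinarith
    nlinarith
  · intro hn5
    have h1 : q < V := by
      have : (C + 1) * T * q < (C + 1) * T * V := by linarith [hlt rfl hn5]
      exact lt_of_mul_lt_mul_left this hCT.le
    have h2 : q < 1 := by linarith
    have : q ^ 2 < 1 := by nlinarith
    nlinarith

/-- A rod at an end of a chord, in an orthonormal frame. -/
lemma ρ_sq (m : ℕ) {x : Fin 3 → ℝ} (hx : lor x x = -1) :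
    s ^ 2 * lor (ρ m) x ^ 2 = s ^ 2 * (lor (t m) x ^ 2 - 1) -
      lor (U m - C • t m) x ^ 2 := by
  obtain ⟨ε, hε, hρ⟩ := h.ρ_eq
  have hs := h.s_pos.ne'
  have e : s ^ 2 • x = (-s ^ 2 * lor (t m) x) • t m + lor (U m - C • t m) x • (U m - C • t m) +
      (s ^ 2 * lor (ρ m) x) • ρ m := by
    rw [← sub_eq_zero]
    have hUt := h.U_t m
    have htU := h.t_U m
    have hUU := h.U_self m
    have htt := h.t_self m
    have hss := h.s_sq
    have hρU := h.ρ_U m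
    have hρt := h.ρ_t m
    have hρρ := h.ρ_self m
    apply eq_zero_of_orthogonal (a := U m) (b := t m)
    · rw [lor_lcross_lcross, hUt, htU, hUU, htt]
      nlinarith [h.one_lt]
    · simp only [lor_sub_left, lor_add_left, lor_smul_left, htU, hUU, hρU,
        lor_comm x (U m)]
      linear_combination (-C * lor (t m) x + lor (U m) x) * hss
    · simp only [lor_sub_left, lor_add_left, lor_smul_left, hUt, htt, hρt,
        lor_comm x (t m)]
      ring
    · have hcr : lcross (U m) (t m) = (ε * s) • ρ m := by
        rw [hρ, smul_smul, show ε * s * (ε / s) = ε ^ 2 by field_simp, hε, one_smul]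
      rw [hcr, lor_smul_right]
      simp only [lor_sub_left, lor_add_left, lor_smul_left, lor_comm (t m) (ρ m),
        lor_comm (U m) (ρ m), lor_comm x (ρ m), hρU, hρt, hρρ]
      ring
  have h2 := congrArg (lor x) e
  simp only [lor_add_right, lor_smul_right, hx, lor_comm x (t m), lor_comm x (ρ m),
    lor_comm x (U m - C • t m)] at h2
  linarith

set_option maxHeartbeats 800000 in
/-- If all the numbers `ch m` are smaller than that of the regular triangle, a chord which makes
acute angles with the rods at its ends is shorter than the side of the regular triangle. -/
lemma chord_lt (hn : Odd n) (hn3 : 3 ≤ n) {p : ℕ} (hp : Odd p) (hpn : p < n) {E c d : ℝ}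
    (hE : lor (U 0) (U p) = -E) (h0 : -lor (t 0) (U p) ≤ C * E) (h0' : -lor (t p) (U 0) ≤ C * E)
    (ht0 : 0 ≤ lor (U 0 - C • t 0) (U p)) (htp : 0 ≤ lor (U p - C • t p) (U 0))
    (hc : 1 < c) (hcC : 2 * c ^ 2 = C * c + 1) (hmax : ∀ m, ch m ≤ d) (hd : d < c) :
    E < C * c := by
  by_contra hcon
  push Not at hcon
  have hC := h.one_lt
  have hs := h.s_pos
  have hd1 : 1 < d := (h.one_lt_ch 0).trans_le (hmax 0)
  have hE1 : 1 < E := by nlinarith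
  have hδ2 := Real.sq_sqrt (show 0 ≤ d ^ 2 - 1 by nlinarith)
  have hδ := Real.sqrt_nonneg (d ^ 2 - 1)
  set δ := √(d ^ 2 - 1)
  have hσ2 := Real.sq_sqrt (show 0 ≤ c ^ 2 - 1 by nlinarith)
  have hσ := Real.sqrt_pos.mpr (show 0 < c ^ 2 - 1 by nlinarith)
  set σ := √(c ^ 2 - 1)
  have hS2 := Real.sq_sqrt (show 0 ≤ E ^ 2 - 1 by nlinarith)
  have hS := Real.sqrt_pos.mpr (show 0 < E ^ 2 - 1 by nlinarith)
  set S := √(E ^ 2 - 1)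
  obtain ⟨Y, V, hYY, hYN, hYp, hY0, hV0, hV, hle, -⟩ := h.displacement_le hn hn3 hp hpn hE h0 h0'
    (fun m => half_tanh_le (h.one_lt_ch m).le (hmax m) hδ (h.ch_sq m) (by linarith))
  have hτ := half_tanh_lt (σ := δ) hd1.le hd hσ.le (by linarith) (by linarith)
  set τ := σ / (1 + c)
  have hlt : lor (U p + t p - (U 0 + t 0)) Y <
      (C + 1) * (τ * (2 - lor (ρ p) Y - lor (ρ 0) Y)) := by
    refine hle.trans_lt (mul_lt_mul_of_pos_left ?_ (by linarith))
    calc δ / (1 + d) * V < τ * V := mul_lt_mul_of_pos_right hτ hV0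
      _ ≤ _ := mul_le_mul_of_nonneg_left hV (by positivity)
  have hR0 : 0 < lor (ρ 0) (U p) := by
    have := h.sep 0 p hp.pos hpn
    rwa [zero_add, hp.add_one.neg_one_pow, one_mul] at this
  have hRp : lor (ρ p) (U 0) < 0 := by
    have := h.sep p (n - p) (by omega) (by have := hp.pos; omega)
    have hodd : Odd (n - p + 1) := by
      have := hp.pos
      rw [Nat.odd_iff] at *
      omega
    have hU := h.U_per 0
    rw [zero_add] at hU
    rw [Nat.add_sub_cancel' hpn.le, hU, hodd.neg_one_pow] at this
    linarith
  have hE' : lor (U p) (U 0) = -E := by rw [lor_comm, hE]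
  have hcomb := eq_comb_of_lor_lcross_eq_zero hE1 (h.U_self 0) (h.U_self p) hE hYN
  have hrel := lor_sq_relation hE1 (h.U_self 0) (h.U_self p) hE hYN hYY
  have q0 := h.ρ_sq 0 (h.U_self p)
  have qp := h.ρ_sq p (h.U_self 0)
  have hss := h.s_sq
  simp only [lor_sub_left, lor_smul_left, hE, hE'] at q0 qp ht0 htp
  have bp := congrArg (lor (ρ p)) hcomb
  have b0 := congrArg (lor (ρ 0)) hcomb
  have tp := congrArg (lor (t p)) hcomb
  have t0 := congrArg (lor (t 0)) hcomb
  simp only [lor_add_right, lor_smul_right, h.ρ_U, h.t_U] at bp b0 tp t0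
  rw [lor_sub_left, lor_add_left, lor_add_left, bp, b0, tp, t0, lor_comm (U p), lor_comm (U 0)]
    at hlt
  have hgg : 0 ≤ -lor Y (U 0) := by linarith
  generalize lor Y (U 0) = g' at *
  obtain ⟨g, rfl⟩ : ∃ g, g' = -g := ⟨-g', by ring⟩
  rw [neg_neg] at hgg hrel
  generalize lor Y (U p) = k at *
  generalize lor (ρ 0) (U p) = R0 at *
  generalize lor (ρ p) (U 0) = Rp at *
  obtain ⟨D0, hD0⟩ : ∃ D, lor (t 0) (U p) = -D := ⟨_, (neg_neg _).symm⟩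
  obtain ⟨Dp, hDp⟩ : ∃ D, lor (t p) (U 0) = -D := ⟨_, (neg_neg _).symm⟩
  rw [hD0] at q0 ht0 hlt
  rw [hDp] at qp htp hlt
  have hS' := hS.ne'
  have hs' := hs.ne'
  have hcc : 2 * c ^ 2 - 1 ≤ E := by linarith
  -- Here `x` and `y` are the cosine and the sine of the angle between chord and rod at `U 0`. The
  -- last condition, from `ht0`, says that the chord does not reach beyond the perpendicular to the
  -- rod at its foot.
  have f0 := angle_estimate (x := (C * E - D0) / (s * S)) (y := R0 / S) hC hs hss hc hcC hσ
    (by linarith) hcon hS hS2 (by positivity)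
    (by
      field_simp
      linear_combination q0 - hss * (E ^ 2 - D0 ^ 2) - s ^ 2 * hS2)
    (by
      rw [show C * S * ((C * E - D0) / (s * S)) = C * (C * E - D0) / s by field_simp,
        div_le_iff₀ hs, show s * E * s = E * C ^ 2 - E by linear_combination E * hss]
      linarith)
  have fp := angle_estimate (x := (C * E - Dp) / (s * S)) (y := -Rp / S) hC hs hss hc hcC hσ
    (by linarith) hcon hS hS2 (by have : 0 < -Rp := by linarith
                                  positivity)
    (by
      field_simp
      linear_combination qp - hss * (E ^ 2 - Dp ^ 2) - s ^ 2 * hS2)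
    (by
      rw [show C * S * ((C * E - Dp) / (s * S)) = C * (C * E - Dp) / s by field_simp,
        div_le_iff₀ hs, show s * E * s = E * C ^ 2 - E by linear_combination E * hss]
      linarith)
  have fc := chord_estimate hc hσ (by linarith) hcc hS hS2 hgg hYp hrel
  set x0 := (C * E - D0) / (s * S) with hx0
  set xp := (C * E - Dp) / (s * S) with hxp
  set y0 := R0 / S with hy0
  set yp := -Rp / S with hyp
  have kx : 0 ≤ (k + E * g) / S := by positivity
  have ky : 0 ≤ (g + E * k) / S := by positivity
  have m0 := mul_le_mul_of_nonneg_right f0 kx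
  have mp := mul_le_mul_of_nonneg_right fp ky
  have eS : E ^ 2 - 1 = S ^ 2 := hS2.symm
  have hE2 : S ^ 2 ≠ 0 := by positivity
  have eD0 : D0 = C * E - s * S * x0 := by rw [hx0]; field_simp; ring
  have eDp : Dp = C * E - s * S * xp := by rw [hxp]; field_simp; ring
  have eR0 : R0 = S * y0 := by rw [hy0]; field_simp
  have eRp : Rp = -(S * yp) := by rw [hyp]; field_simp
  -- With `Y` resolved along the chord, the displacement involves only the cosines `x0`, `xp`, and
  -- the products with `ρ 0`, `ρ p` only the sines `y0`, `yp`. The angle and chord estimates then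
  -- contradict `hlt`.
  have hl : k + ((-g - E * k) / (E ^ 2 - 1) * -Dp + (k - E * -g) / (E ^ 2 - 1) * -C) -
      (-g + ((-g - E * k) / (E ^ 2 - 1) * -C + (k - E * -g) / (E ^ 2 - 1) * -D0)) =
      (C + 1) * (g + k) - s * x0 * ((k + E * g) / S) - s * xp * ((g + E * k) / S) := by
    rw [eS, eDp, eD0]
    field_simp
    linear_combination (C * (g + k)) * eS
  have hr : (-g - E * k) / (E ^ 2 - 1) * Rp + (k - E * -g) / (E ^ 2 - 1) * 0 =
      yp * ((g + E * k) / S) := by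
    rw [eS, eRp]
    field_simp
    ring
  have hr' : (-g - E * k) / (E ^ 2 - 1) * 0 + (k - E * -g) / (E ^ 2 - 1) * R0 =
      y0 * ((k + E * g) / S) := by
    rw [eS, eR0]
    field_simp
    ring
  rw [hl, hr, hr'] at hlt
  have := mul_le_mul_of_nonneg_left fc (show 0 ≤ C + 1 by linarith)
  linarith

end IsRodSystem

/-! ### From reduced polygons to chains of rods -/

/-- The vertices `x i` of an ordinary reduced polygon with `2 * k + 1` vertices and the feet `z i`
of the perpendiculars from them to the opposite sides, in the hyperboloid model. The number `C` is
the hyperbolic cosine of the minimal width, and `ε` is the orientation. -/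
structure IsReducedConfig (k : ℕ) (C ε : ℝ) (x z : ZMod (2 * k + 1) → Fin 3 → ℝ) : Prop where
  one_le : 1 ≤ k
  one_lt : 1 < C
  x_self : ∀ i, lor (x i) (x i) = -1
  z_self : ∀ i, lor (z i) (z i) = -1
  x_z : ∀ i, lor (x i) (z i) = -C
  lor_le : ∀ i j, lor (x i) (x j) ≤ -1
  perp : ∀ i, lor (x i - C • z i) (x (i + k)) = 0
  perp' : ∀ i, lor (x i - C • z i) (x (i + k + 1)) = 0
  foot : ∀ i, ∃ p q : ℝ, 0 < p ∧ 0 < q ∧ z i = p • x (i + k) + q • x (i + k + 1)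
  height : ∀ i j, 0 ≤ lor (x i - C • z i) (x j)
  ε_sq : ε ^ 2 = 1
  orient : ∀ i (a b : ℕ), 0 < a → a < b → b < 2 * k + 1 →
    0 < ε * det3 (x i) (x (i + a)) (x (i + b))

/-- Decomposition in the frame of a rod of a vector orthogonal to its direction at the foot. -/
lemma eq_comb_of_perp {u z ρ X : Fin 3 → ℝ} {C s ε : ℝ} (hs : s ≠ 0) (hss : s ^ 2 = C ^ 2 - 1)
    (hε : ε ^ 2 = 1) (hu : lor u u = -1) (hz : lor z z = -1) (huz : lor u z = -C)
    (hρ : ρ = (ε / s) • lcross u z) (hX : lor (u - C • z) X = 0) :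
    X = (-lor z X) • z + lor ρ X • ρ := by
  have hzu : lor z u = -C := by rw [lor_comm, huz]
  have hcr : lor (lcross u z) (lcross u z) = s ^ 2 := by
    rw [lor_lcross_lcross, hu, hz, huz, hzu, hss]; ring
  have hρu : lor ρ u = 0 := by rw [hρ, lor_smul_left, lor_lcross_left, mul_zero]
  have hρz : lor ρ z = 0 := by rw [hρ, lor_smul_left, lor_lcross_right, mul_zero]
  rw [lor_sub_left, lor_smul_left] at hX
  rw [← sub_eq_zero]
  apply eq_zero_of_orthogonal (a := u) (b := z) (by rw [hcr]; positivity)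
  · simp only [lor_sub_left, lor_add_left, lor_smul_left, hρu, hzu, lor_comm X u]
    linarith
  · simp only [lor_sub_left, lor_add_left, lor_smul_left, hρz, hz, lor_comm X z]
    ring
  · simp only [lor_sub_left, lor_add_left, lor_smul_left, hρ, hcr, lor_comm z (lcross u z),
      lor_lcross_right, lor_comm X (lcross u z)]
    field_simp
    linear_combination (-lor (lcross u z) X) * hε

namespace IsReducedConfig

variable {k : ℕ} {C ε : ℝ} {x z : ZMod (2 * k + 1) → Fin 3 → ℝ}

lemma two_mul_add_one_eq_zero (k : ℕ) : 2 * (k : ZMod (2 * k + 1)) + 1 = 0 := by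
  have := ZMod.natCast_self (2 * k + 1)
  push_cast at this
  exact this

/-- The unit normal of the line of a rod. -/
def rodNormal (ε s : ℝ) (x z : ZMod (2 * k + 1) → Fin 3 → ℝ) (i : ZMod (2 * k + 1)) :
    Fin 3 → ℝ := (ε / s) • lcross (x i) (z i)

section

variable (h : IsReducedConfig k C ε x z)
include h

/-- Modulo `2 * k + 1`, `k + 1` is the inverse of 2. Hence an even `q = 2 b` leads to the vertex `i
+ b`, before the foot of rod `i`, and an odd `q = 2 b + 1` to `i + k + 1 + b`, after it. -/
lemma rod_sep {s : ℝ} (hs : 0 < s) (i : ZMod (2 * k + 1)) {q : ℕ} (hq : 1 ≤ q)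
    (hq' : q < 2 * k + 1) :
    0 < (-1) ^ (q + 1) * lor (rodNormal ε s x z i) (x (i + (k + 1) * q)) := by
  have hk := h.one_le
  have h0 := two_mul_add_one_eq_zero k
  obtain ⟨p, r, hp, hr, hz⟩ := h.foot i
  have e : ∀ X, lor (rodNormal ε s x z i) X = s⁻¹ * (p * (ε * det3 (x i) (x (i + k)) X) +
      r * (ε * det3 (x i) (x (i + k + 1)) X)) := by
    intro X
    rw [rodNormal, lor_smul_left]
    change ε / s * det3 (x i) (z i) X = _
    rw [hz, det3_comb_mid]
    ring
  have hk1 : i + k + 1 = i + ((k + 1 : ℕ) : ZMod (2 * k + 1)) := by push_cast; ring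
  have hs' : 0 < s⁻¹ := inv_pos.mpr hs
  rw [e]
  rcases Nat.even_or_odd' q with ⟨b, rfl | rfl⟩
  · have eb : i + (k + 1) * ((2 * b : ℕ) : ZMod (2 * k + 1)) = i + (b : ℕ) := by
      push_cast
      linear_combination b * h0
    rw [eb, pow_succ, pow_mul]
    have h1 : p * (ε * det3 (x i) (x (i + k)) (x (i + (b : ℕ)))) ≤ 0 := by
      rcases (show b ≤ k by omega).eq_or_lt with rfl | hb
      · rw [det3_self_right]; simp
      · have := h.orient i b k (by omega) hb (by omega)
        rw [det3_swap]
        nlinarith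
    have h2 : r * (ε * det3 (x i) (x (i + k + 1)) (x (i + (b : ℕ)))) < 0 := by
      have := h.orient i b (k + 1) (by omega) (by omega) (by omega)
      rw [det3_swap, hk1]
      nlinarith
    have := mul_pos hs' (show 0 < -(p * (ε * det3 (x i) (x (i + k)) (x (i + (b : ℕ)))) +
      r * (ε * det3 (x i) (x (i + k + 1)) (x (i + (b : ℕ))))) by linarith)
    norm_num
    linarith
  · have eb : i + (k + 1) * ((2 * b + 1 : ℕ) : ZMod (2 * k + 1)) =
        i + ((k + 1 + b : ℕ) : ZMod (2 * k + 1)) := by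
      push_cast
      linear_combination b * h0
    rw [eb, pow_succ, pow_succ, pow_mul]
    have h1 : 0 < p * (ε * det3 (x i) (x (i + k)) (x (i + ((k + 1 + b : ℕ) : ZMod _)))) :=
      mul_pos hp (h.orient i k (k + 1 + b) (by omega) (by omega) (by omega))
    have h2 : 0 ≤ r * (ε * det3 (x i) (x (i + k + 1))
        (x (i + ((k + 1 + b : ℕ) : ZMod _)))) := by
      rw [hk1]
      rcases Nat.eq_zero_or_pos b with rfl | hb
      · rw [add_zero, det3_self_right]; simp
      · exact (mul_pos hr (h.orient i (k + 1) (k + 1 + b) (by omega) (by omega) (by omega))).le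
    have := mul_pos hs' (show 0 < p * (ε * det3 (x i) (x (i + k))
      (x (i + ((k + 1 + b : ℕ) : ZMod _)))) + r * (ε * det3 (x i) (x (i + k + 1))
        (x (i + ((k + 1 + b : ℕ) : ZMod _)))) by linarith)
    norm_num at this ⊢
    exact this

lemma lor_succ (i : ZMod (2 * k + 1)) :
    lor (x i) (x (i + k + 1)) = C * lor (z i) (x (i + k + 1)) := by
  have := h.perp' i
  rw [lor_sub_left, lor_smul_left] at this
  linarith

/-- The rods in the order in which consecutive ones have adjacent end points. -/
lemma isRodSystem (a : ZMod (2 * k + 1)) : ∃ (ρ : ℕ → Fin 3 → ℝ) (sh : ℕ → ℝ),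
    IsRodSystem (2 * k + 1) C √(C ^ 2 - 1) (fun m => x (a + (k + 1) * m))
      (fun m => z (a + (k + 1) * m)) ρ
      (fun m => -lor (z (a + (k + 1) * m)) (x (a + (k + 1) * m + k + 1))) sh := by
  have hC := h.one_lt
  have hs : 0 < √(C ^ 2 - 1) := Real.sqrt_pos.mpr (by nlinarith)
  have hss : √(C ^ 2 - 1) ^ 2 = C ^ 2 - 1 := Real.sq_sqrt (by nlinarith)
  set s := √(C ^ 2 - 1)
  have h0 := two_mul_add_one_eq_zero k
  have hnext : ∀ i : ZMod (2 * k + 1), i + k + 1 + k = i := fun i => by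
    linear_combination h0
  have hstep : ∀ m : ℕ, a + (k + 1) * ((m + 1 : ℕ) : ZMod (2 * k + 1)) =
      a + (k + 1) * m + k + 1 := fun m => by push_cast; ring
  have hdec := fun i X => eq_comb_of_perp (ρ := rodNormal ε s x z i) (X := X) hs.ne' hss h.ε_sq
    (h.x_self i) (h.z_self i) (h.x_z i) rfl
  have hρz : ∀ i, lor (rodNormal ε s x z i) (z i) = 0 := fun i => by
    rw [rodNormal, lor_smul_left, lor_lcross_right, mul_zero]
  have hρρ : ∀ i, lor (rodNormal ε s x z i) (rodNormal ε s x z i) = 1 := fun i => by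
    have hzx : lor (z i) (x i) = -C := by rw [lor_comm, h.x_z]
    have := h.ε_sq
    have hs' := hs.ne'
    rw [rodNormal, lor_smul_left, lor_smul_right, lor_lcross_lcross, h.x_z, hzx, h.x_self,
      h.z_self]
    field_simp
    linear_combination (C ^ 2 - 1) * this - hss
  have hunit : ∀ i j, lor (x i - C • z i) (x j) = 0 →
      lor (z i) (x j) ^ 2 = lor (rodNormal ε s x z i) (x j) ^ 2 + 1 := by
    intro i j hij
    have h1 := congrArg (lor (x j)) (hdec i (x j) hij)
    rw [h.x_self, lor_add_right, lor_smul_right, lor_smul_right, lor_comm (x j),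
      lor_comm (x j)] at h1
    linear_combination h1
  -- Two right triangles share the hypotenuse from `x i` to `x (i + k + 1)` and have a leg of length
  -- `arcosh C`, so their other legs agree.
  have hsym : ∀ i, lor (z (i + k + 1)) (x i) = lor (z i) (x (i + k + 1)) := by
    intro i
    have h1 := h.perp (i + k + 1)
    rw [hnext, lor_sub_left, lor_smul_left, lor_comm (x _), h.lor_succ i, ← mul_sub] at h1
    have := (mul_eq_zero.mp h1).resolve_left (by linarith)
    linarith
  have hsep1 : ∀ i, 0 < lor (rodNormal ε s x z i) (x (i + k + 1)) := by
    intro i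
    have := h.rod_sep hs i le_rfl (by have := h.one_le; omega)
    have e : i + (k + 1) * ((1 : ℕ) : ZMod (2 * k + 1)) = i + k + 1 := by push_cast; ring
    rw [e] at this
    norm_num at this
    exact this
  have hsep2 : ∀ i, lor (rodNormal ε s x z (i + k + 1)) (x i) < 0 := by
    intro i
    have := h.rod_sep hs (i + k + 1) (q := 2 * k) (by have := h.one_le; omega) (by omega)
    have e : i + k + 1 + (k + 1) * ((2 * k : ℕ) : ZMod (2 * k + 1)) = i := by
      push_cast; linear_combination (k + 1) * h0
    rw [e, pow_succ, pow_mul] at this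
    norm_num at this
    exact this
  have hanti : ∀ i, lor (rodNormal ε s x z (i + k + 1)) (x i) =
      -lor (rodNormal ε s x z i) (x (i + k + 1)) := by
    intro i
    have h1 := hunit i (i + k + 1) (h.perp' i)
    have h2 := hunit (i + k + 1) i (by have := h.perp (i + k + 1); rwa [hnext] at this)
    rw [hsym] at h2
    have h3 : (lor (rodNormal ε s x z (i + k + 1)) (x i) -
        lor (rodNormal ε s x z i) (x (i + k + 1))) *
        (lor (rodNormal ε s x z (i + k + 1)) (x i) +
        lor (rodNormal ε s x z i) (x (i + k + 1))) = 0 := by linarith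
    rcases mul_eq_zero.mp h3 with h4 | h4
    · linarith [hsep1 i, hsep2 i]
    · linarith
  refine ⟨fun m => rodNormal ε s x z (a + (k + 1) * m),
    fun m => lor (rodNormal ε s x z (a + (k + 1) * m)) (x (a + (k + 1) * m + k + 1)), ?_⟩
  constructor
  · exact hC
  · exact hs
  · exact hss
  · exact fun m => h.x_self _
  · exact fun m => h.z_self _
  · exact fun m => h.x_z _
  · exact ⟨ε, h.ε_sq, fun m => rfl⟩
  · intro m
    simp only [hstep]
    exact hdec _ _ (h.perp' _)
  · intro m
    simp only [hstep]
    have h1 := hdec (a + (k + 1) * m + k + 1) (x (a + (k + 1) * m))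
      (by have := h.perp (a + (k + 1) * m + k + 1); rwa [hnext] at this)
    rw [hsym, hanti] at h1
    rw [sub_eq_add_neg, ← neg_smul]
    exact h1
  · exact fun m => hsep1 _
  · intro m
    have h1 := h.lor_succ (a + (k + 1) * m)
    have h2 := h.lor_le (a + (k + 1) * m) (a + (k + 1) * m + k + 1)
    rw [h1] at h2
    by_contra hcon
    push Not at hcon
    nlinarith
  · intro m
    rw [neg_sq]
    exact hunit _ _ (h.perp' _)
  · intro m q hq hq'
    have := h.rod_sep hs (a + (k + 1) * m) hq hq'
    rw [show a + (k + 1) * m + (k + 1) * (q : ZMod (2 * k + 1)) =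
      a + (k + 1) * ((m + q : ℕ) : ZMod (2 * k + 1)) by push_cast; ring] at this
    exact this
  all_goals
    intro m
    simp only [Nat.cast_add m (2 * k + 1), ZMod.natCast_self, add_zero]

/-! ### Chords of reduced polygons and the case of equality -/

/-- The hyperbolic cosine of the distance of a foot from an end of its side. -/
lemma neg_lor_foot_le {c : ℝ} (hc : 1 < c) (hcC : 2 * c ^ 2 = C * c + 1) :
    (∀ i, -lor (z i) (x (i + k + 1)) ≤ c) ∧
      (2 ≤ k → ∃ d < c, ∀ i, -lor (z i) (x (i + k + 1)) ≤ d) := by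
  obtain ⟨M, hM⟩ := Finite.exists_max fun i => -lor (z i) (x (i + k + 1))
  obtain ⟨ρ, sh, hR⟩ := h.isRodSystem M
  have hk := h.one_le
  have h1 := hR.two_mul_ch_sq_le ⟨k, rfl⟩ (by omega)
    (fun m => by
      have := hM (M + (k + 1) * m)
      simpa using this)
  have hch := hR.one_lt_ch 0
  simp only [Nat.cast_zero, mul_zero, add_zero] at h1 hch
  set e := -lor (z M) (x (M + k + 1))
  -- One root of the quadratic is `c`; the other, `C / 2 - c`, is less than 1.
  have hfac : 2 * e ^ 2 - (C * e + 1) = (e - c) * (2 * e + 2 * c - C) := by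
    linear_combination hcC
  have hpos : 0 < 2 * e + 2 * c - C := by nlinarith
  have hec : e ≤ c := by
    by_contra hcon
    push Not at hcon
    have := mul_pos (sub_pos.mpr hcon) hpos
    linarith [h1.1]
  refine ⟨fun i => (hM i).trans hec, fun hk2 => ⟨e, ?_, hM⟩⟩
  refine lt_of_le_of_ne hec fun he => ?_
  have := h1.2 (by omega)
  rw [he, sub_self, zero_mul] at hfac
  rw [he] at this
  linarith

/-- A foot lies on a side, so its coefficients have sum at most 1 and it is no farther from `x j`
than the longest chord. -/
lemma neg_lor_foot_le_of_max {i j : ZMod (2 * k + 1)} {E : ℝ}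
    (hE : ∀ i j, -lor (x i) (x j) ≤ E) : -lor (z i) (x j) ≤ C * E := by
  obtain ⟨p, q, hp, hq, hz⟩ := h.foot i
  have h1 := h.z_self i
  have hD := h.lor_le (i + k) (i + k + 1)
  have hD' := h.lor_le (i + k + 1) (i + k)
  have hpq : p + q ≤ 1 := by
    rw [hz] at h1
    simp only [lor_add_left, lor_add_right, lor_smul_left, lor_smul_right, h.x_self] at h1
    have := mul_le_mul_of_nonneg_left hD (mul_pos hp hq).le
    have := mul_le_mul_of_nonneg_left hD' (mul_pos hp hq).le
    nlinarith
  have hE1 : 1 ≤ E := by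
    have := hE 0 0
    rw [h.x_self] at this
    linarith
  rw [hz, lor_add_left, lor_smul_left, lor_smul_left]
  have h2 := mul_le_mul_of_nonneg_left (hE (i + k) j) hp.le
  have h3 := mul_le_mul_of_nonneg_left (hE (i + k + 1) j) hq.le
  nlinarith [h.one_lt]

/-- In a polygon with at least five vertices every chord is shorter than the side of the regular
triangle. -/
lemma neg_lor_lt (hk : 2 ≤ k) {c : ℝ} (hc : 1 < c) (hcC : 2 * c ^ 2 = C * c + 1)
    (i j : ZMod (2 * k + 1)) : -lor (x i) (x j) < C * c := by
  obtain ⟨⟨i₀, j₀⟩, hmax⟩ := Finite.exists_max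
    fun q : ZMod (2 * k + 1) × ZMod (2 * k + 1) => -lor (x q.1) (x q.2)
  simp only [Prod.forall] at hmax
  refine (hmax i j).trans_lt ?_
  have h0 := two_mul_add_one_eq_zero k
  obtain ⟨d, hd, hch⟩ := (h.neg_lor_foot_le hc hcC).2 hk
  have key : ∀ (i : ZMod (2 * k + 1)) (p : ℕ), Odd p → p < 2 * k + 1 →
      (∀ a b, -lor (x a) (x b) ≤ -lor (x i) (x (i + (k + 1) * p))) →
      -lor (x i) (x (i + (k + 1) * p)) < C * c := by
    intro i p hp hpn hm
    obtain ⟨ρ, sh, hR⟩ := h.isRodSystem i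
    refine hR.chord_lt ⟨k, rfl⟩ (by omega) hp hpn (E := -lor (x i) (x (i + (k + 1) * p)))
      (d := d) ?_ ?_ ?_ ?_ ?_ hc hcC (fun m => hch _) hd
    · simp
    · exact h.neg_lor_foot_le_of_max hm
    · exact h.neg_lor_foot_le_of_max hm
    · exact h.height _ _
    · exact h.height _ _
  -- As `k + 1` inverts 2, `j₀` is vertex number `q` of the chain starting at `i₀`. If `q` is even
  -- and positive, the chain from `j₀` reaches `i₀` at the odd number `2 * k + 1 - q`.
  set q := (2 * (j₀ - i₀)).val with hq
  have hqc : (q : ZMod (2 * k + 1)) = 2 * (j₀ - i₀) := ZMod.natCast_zmod_val _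
  have hqlt : q < 2 * k + 1 := ZMod.val_lt _
  have hj : i₀ + (k + 1) * (q : ZMod (2 * k + 1)) = j₀ := by
    rw [hqc]; linear_combination (j₀ - i₀) * h0
  rcases Nat.even_or_odd q with hq2 | hq2
  · rcases Nat.eq_zero_or_pos q with hq0 | hq0
    · have : i₀ = j₀ := by rw [← hj, hq0]; simp
      rw [this, h.x_self]
      nlinarith [h.one_lt]
    · have hi : j₀ + (k + 1) * ((2 * k + 1 - q : ℕ) : ZMod (2 * k + 1)) = i₀ := by
        rw [Nat.cast_sub hqlt.le, ZMod.natCast_self, ← hj]; ring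
      have := key j₀ (2 * k + 1 - q)
        (by rw [Nat.even_iff] at hq2; rw [Nat.odd_iff]; omega) (by omega)
        (fun a b => by rw [hi, lor_comm (x j₀)]; exact hmax a b)
      rwa [hi, lor_comm] at this
  · have := key i₀ q hq2 hqlt (fun a b => by rw [hj]; exact hmax a b)
    rwa [hj] at this

lemma eq_or_eq_of_triangle (hk : k = 1) {i j : ZMod (2 * k + 1)} (hij : i ≠ j) :
    j = i + k + 1 ∨ i = j + k + 1 := by
  subst hk
  revert i j
  decide

lemma neg_lor_le_of_triangle (hk : k = 1) {c : ℝ} (hc : 1 < c) (hcC : 2 * c ^ 2 = C * c + 1)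
    (i j : ZMod (2 * k + 1)) : -lor (x i) (x j) ≤ C * c := by
  have hC := h.one_lt
  have key : ∀ i, -lor (x i) (x (i + k + 1)) ≤ C * c := fun i => by
    rw [h.lor_succ]
    have := (h.neg_lor_foot_le hc hcC).1 i
    nlinarith
  by_cases hij : i = j
  · rw [hij, h.x_self]
    nlinarith
  · rcases h.eq_or_eq_of_triangle hk hij with h1 | h1
    · rw [h1]; exact key i
    · rw [lor_comm, h1]; exact key j

/-- The relation between the three sides of a triangle with equal heights. -/
lemma triangle_relation (hk : k = 1) (i : ZMod (2 * k + 1)) : ∃ e₁ e₂ σ₁ σ₂ : ℝ,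
    e₁ = -lor (z (i + k + 1)) (x (i + k + 1 + k + 1)) ∧
    e₂ = -lor (z (i + k + 1 + k + 1)) (x (i + k + 1 + k + 1 + k + 1)) ∧
    1 < e₁ ∧ 1 < e₂ ∧ 0 < σ₁ ∧ 0 < σ₂ ∧ e₁ ^ 2 = σ₁ ^ 2 + 1 ∧ e₂ ^ 2 = σ₂ ^ 2 + 1 ∧
    C * -lor (z i) (x (i + k + 1)) = e₁ * e₂ + σ₁ * σ₂ := by
  obtain ⟨ρ, sh, hR⟩ := h.isRodSystem i
  have h1 : i + (k + 1) * ((1 : ℕ) : ZMod (2 * k + 1)) = i + k + 1 := by push_cast; ring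
  have h2 : i + (k + 1) * ((2 : ℕ) : ZMod (2 * k + 1)) = i + k + 1 + k + 1 := by
    push_cast; ring
  have hrel := hR.lor_succ_succ 1
  have h3 : i + (k + 1) * ((1 + 2 : ℕ) : ZMod (2 * k + 1)) = i := by
    rw [show 1 + 2 = 2 * k + 1 by omega, ZMod.natCast_self, mul_zero, add_zero]
  have h01 := hR.succ_U 0
  have e1 := hR.one_lt_ch 1
  have e2 := hR.one_lt_ch 2
  have q1 := hR.ch_sq 1
  have q2 := hR.ch_sq 2
  have h0 : i + (k + 1) * ((0 : ℕ) : ZMod (2 * k + 1)) = i := by simp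
  simp only [h3] at hrel
  simp only [Nat.reduceAdd, h0, h1, h2] at hrel h01 e1 e2 q1 q2
  rw [h01] at hrel
  refine ⟨_, _, sh 1, sh 2, rfl, rfl, e1, e2, hR.sh_pos 1, hR.sh_pos 2, q1, q2, ?_⟩
  linarith

/-- If one of the three numbers attains its bound `c`, then `C c = e₁ e₂ + σ₁ σ₂ ≤ c² + (c² - 1) = C
c` forces the other two to attain it. -/
lemma triangle_of_eq (hk : k = 1) {c : ℝ} (hc : 1 < c) (hcC : 2 * c ^ 2 = C * c + 1)
    {i₀ j₀ : ZMod (2 * k + 1)} (heq : -lor (x i₀) (x j₀) = C * c) {i j : ZMod (2 * k + 1)}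
    (hij : i ≠ j) : -lor (x i) (x j) = C * c := by
  have hC := h.one_lt
  have hle := (h.neg_lor_foot_le hc hcC).1
  have hij₀ : i₀ ≠ j₀ := by
    rintro rfl
    rw [h.x_self] at heq
    nlinarith
  have hM : ∃ M, -lor (z M) (x (M + k + 1)) = c := by
    rcases h.eq_or_eq_of_triangle hk hij₀ with h1 | h1
    · refine ⟨i₀, ?_⟩
      rw [h1, h.lor_succ, ← mul_neg] at heq
      exact mul_left_cancel₀ (by linarith) heq
    · refine ⟨j₀, ?_⟩
      rw [h1, lor_comm, h.lor_succ, ← mul_neg] at heq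
      exact mul_left_cancel₀ (by linarith) heq
  obtain ⟨M, hM⟩ := hM
  obtain ⟨e₁, e₂, σ₁, σ₂, he₁, he₂, h1, h2, hσ₁, hσ₂, q1, q2, hrel⟩ := h.triangle_relation hk M
  have b1 : e₁ ≤ c := he₁ ▸ hle _
  have b2 : e₂ ≤ c := he₂ ▸ hle _
  rw [hM] at hrel
  have hσ : σ₁ * σ₂ ≤ c ^ 2 - 1 := by nlinarith [sq_nonneg (σ₁ - σ₂)]
  have c1 : e₁ = c := by nlinarith
  have c2 : e₂ = c := by nlinarith
  have hall : ∀ i, -lor (z i) (x (i + k + 1)) = c := by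
    intro i
    have h3 : i = M ∨ i = M + k + 1 ∨ i = M + k + 1 + k + 1 := by
      clear * - hk
      subst hk
      revert i M
      decide
    rcases h3 with rfl | rfl | rfl
    · exact hM
    · rw [← he₁, c1]
    · rw [← he₂, c2]
  rcases h.eq_or_eq_of_triangle hk hij with h1 | h1
  · rw [h1, h.lor_succ, ← mul_neg, hall]
  · rw [lor_comm, h1, h.lor_succ, ← mul_neg, hall]

/-- For equal sides `triangle_relation` becomes `C e = 2 e² - 1`, whose only root above 1 is `c`. -/
lemma eq_of_equilateral (hk : k = 1) {c : ℝ} (hc : 1 < c) (hcC : 2 * c ^ 2 = C * c + 1) {E : ℝ}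
    (hE : ∀ i j, i ≠ j → -lor (x i) (x j) = E) : E = C * c := by
  have hC := h.one_lt
  have hne : ∀ i : ZMod (2 * k + 1), i ≠ i + k + 1 := by
    subst hk
    decide
  have hall : ∀ i, C * -lor (z i) (x (i + k + 1)) = E := fun i => by
    rw [mul_neg, ← h.lor_succ]; exact hE _ _ (hne i)
  obtain ⟨e₁, e₂, σ₁, σ₂, he₁, he₂, h1, h2, hσ₁, hσ₂, q1, q2, hrel⟩ := h.triangle_relation hk 0
  have h3 : C * e₁ = E := he₁ ▸ hall _
  have h4 : C * e₂ = E := he₂ ▸ hall _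
  have h5 : e₁ = e₂ := mul_left_cancel₀ (by linarith) (h3.trans h4.symm)
  subst h5
  have h6 : σ₁ = σ₂ := (sq_eq_sq₀ hσ₁.le hσ₂.le).mp (by linarith)
  subst h6
  rw [hall, ← h3] at hrel
  have hfac : (e₁ - c) * (2 * e₁ + 2 * c - C) = 0 := by
    linear_combination q1 - hcC - hrel
  have hpos : 0 < 2 * e₁ + 2 * c - C := by nlinarith
  have := (mul_eq_zero.mp hfac).resolve_right hpos.ne'
  rw [← h3, sub_eq_zero.mp this]

end

end IsReducedConfig

/-! ### Convex polygons in the hyperboloid model -/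

lemma emb_collinear {a b c : ℍ} (hab : a ≠ b) (h : det3 (emb a) (emb b) (emb c) = 0) :
    c ∈ seg a b ∨ b ∈ seg a c ∨ a ∈ seg b c := by
  have hE : 1 < Real.cosh (dist a b) := Real.one_lt_cosh.mpr (dist_pos.mpr hab).ne'
  have hc := eq_comb_of_lor_lcross_eq_zero hE (lor_emb_self a) (lor_emb_self b) (lor_emb a b)
    (Y := emb c) (by rw [lor_comm]; exact h)
  set α := (lor (emb c) (emb a) - Real.cosh (dist a b) * lor (emb c) (emb b)) /
    (Real.cosh (dist a b) ^ 2 - 1)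
  set β := (lor (emb c) (emb b) - Real.cosh (dist a b) * lor (emb c) (emb a)) /
    (Real.cosh (dist a b) ^ 2 - 1)
  have ha0 := emb_zero_pos a
  have hb0 := emb_zero_pos b
  have hc0 := emb_zero_pos c
  have hsum : emb c 0 = α * emb a 0 + β * emb b 0 := by
    conv_lhs => rw [hc]
    simp
  -- The signs of the coefficients tell which point is between the others; they are not both
  -- nonpositive, because the time coordinates are positive.
  rcases le_or_gt 0 α with hα | hα
  · rcases le_or_gt 0 β with hβ | hβ
    · exact Or.inl (mem_seg_of_comb hα hβ hc)
    · have hα' : 0 < α := by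
        by_contra hcon
        have : α = 0 := le_antisymm (not_lt.mp hcon) hα
        rw [this] at hsum
        nlinarith
      refine Or.inr (Or.inr (mem_seg_of_comb (p := -β / α) (q := 1 / α) ?_ ?_ ?_))
      · exact div_nonneg (by linarith) hα
      · positivity
      · rw [hc, smul_add, smul_smul, smul_smul, one_div, inv_mul_cancel₀ hα'.ne']
        module
  · have hβ' : 0 < β := by
      by_contra hcon
      push Not at hcon
      nlinarith
    refine Or.inr (Or.inl (mem_seg_of_comb (p := -α / β) (q := 1 / β) ?_ ?_ ?_))
    · exact div_nonneg (by linarith) hβ'.le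
    · positivity
    · rw [hc, smul_add, smul_smul, smul_smul, one_div, inv_mul_cancel₀ hβ'.ne']
      module

lemma IsLine.exists_normal {l : Set ℍ} (hl : IsLine l) :
    ∃ N, lor N N = 1 ∧ l = {z | lor N (emb z) = 0} := by
  obtain ⟨a, b, c, h, rfl⟩ := hl
  have hpos : 0 < lor (normal a b c) (normal a b c) := by rw [lor_normal]; linarith
  have hs := Real.sqrt_pos.mpr hpos
  have hs2 := Real.sq_sqrt hpos.le
  refine ⟨(√(lor (normal a b c) (normal a b c)))⁻¹ • normal a b c, ?_, ?_⟩
  · rw [lor_smul_left, lor_smul_right]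
    field_simp
    exact hs2.symm
  · ext z
    simp only [Set.mem_ofPred_eq]
    rw [form_eq_zero_iff, lor_smul_left, mul_eq_zero, or_iff_right (inv_pos.mpr hs).ne']

lemma IsSupportingLine.exists_normal {K l : Set ℍ} (hl : IsSupportingLine K l) :
    ∃ N, 0 < lor N N ∧ (∀ z ∈ l, lor N (emb z) = 0) ∧ ∀ z ∈ K, 0 ≤ lor N (emb z) := by
  obtain ⟨H, ⟨a, b, c, h, rfl, rfl⟩, hK⟩ := hl.one_side
  exact ⟨normal a b c, by rw [lor_normal]; linarith, fun z hz => (form_eq_zero_iff a b c z).mp hz,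
    fun z hz => (form_nonneg_iff a b c z).mp (hK hz)⟩

/-- The foot of a perpendicular in the hyperboloid model. -/
lemma IsProjection.emb_eq {N : Fin 3 → ℝ} (hN : lor N N = 1) {p t : ℍ}
    (h : IsProjection {z | lor N (emb z) = 0} p t) :
    emb p = Real.cosh (dist p t) • emb t + lor (emb p) N • N := by
  set β := lor (emb p) N with hβ
  have hr : 0 < 1 + β ^ 2 := by positivity
  have hs := Real.sqrt_pos.mpr hr
  have hs2 := Real.sq_sqrt hr.le
  set r := √(1 + β ^ 2)
  have hNp : lor N (emb p) = β := lor_comm _ _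
  have hff : lor (r⁻¹ • (emb p - β • N)) (r⁻¹ • (emb p - β • N)) = -1 := by
    simp only [lor_smul_left, lor_smul_right, lor_sub_left, lor_sub_right, lor_emb_self, hN, hNp,
      ← hβ]
    field_simp
    linarith
  -- The timelike vector `emb p - β • N` has a negative product with `emb p`, so by Cauchy–Schwarz
  -- it points to the same sheet.
  obtain ⟨z₀, hz₀⟩ : ∃ z₀, emb z₀ = r⁻¹ • (emb p - β • N) := by
    refine exists_emb_eq hff ?_
    by_contra hcon
    push Not at hcon
    have hup : (emb p - β • N) 0 ≤ 0 := by
      have : (r⁻¹ • (emb p - β • N)) 0 = r⁻¹ * (emb p - β • N) 0 := rfl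
      rw [this] at hcon
      have := inv_pos.mpr hs
      by_contra h2
      push Not at h2
      nlinarith [mul_pos this h2]
    have h1 : lor (emb p - β • N) (emb p - β • N) = -(1 + β ^ 2) := by
      simp only [lor_smul_left, lor_smul_right, lor_sub_left, lor_sub_right, lor_emb_self, hN,
        hNp, ← hβ]
      ring
    have h2 : lor (emb p - β • N) (emb p) = -(1 + β ^ 2) := by
      simp only [lor_smul_left, lor_sub_left, lor_emb_self, hNp]
      ring
    have h3 := lor_emb_self p
    have h4 := emb_zero_pos p
    set f := emb p - β • N
    simp only [lor] at h1 h2 h3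
    set u := emb p
    have h5 : f 1 * u 1 + f 2 * u 2 < 0 := by nlinarith
    have h6 : (f 1 * u 1 + f 2 * u 2) ^ 2 ≤ (f 1 ^ 2 + f 2 ^ 2) * (u 1 ^ 2 + u 2 ^ 2) := by
      nlinarith [sq_nonneg (f 1 * u 2 - f 2 * u 1)]
    have h7 : f 1 ^ 2 + f 2 ^ 2 = f 0 ^ 2 - (1 + β ^ 2) := by linarith
    have h8 : u 1 ^ 2 + u 2 ^ 2 = u 0 ^ 2 - 1 := by linarith
    have h9 : f 1 * u 1 + f 2 * u 2 = f 0 * u 0 - (1 + β ^ 2) := by linarith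
    have h10 : f 0 * u 0 ≤ 0 := mul_nonpos_of_nonpos_of_nonneg hup h4.le
    rw [h7, h8, h9] at h6
    nlinarith [sq_nonneg (f 0), sq_nonneg (u 0), mul_nonneg hr.le (sq_nonneg (u 0))]
  have hpe : emb p = r • emb z₀ + β • N := by
    rw [hz₀, smul_smul, mul_inv_cancel₀ hs.ne', one_smul]
    module
  have hz₀l : lor N (emb z₀) = 0 := by
    rw [hz₀, lor_smul_right, lor_sub_right, lor_smul_right, hN, hNp]; ring
  have hdist : ∀ s, lor N (emb s) = 0 →
      Real.cosh (dist p s) = r * Real.cosh (dist z₀ s) := by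
    intro s hs0
    have h1 := lor_emb p s
    rw [hpe, lor_add_left, lor_smul_left, lor_smul_left, hs0, lor_emb] at h1
    linarith
  have h1 : dist p t ≤ dist p z₀ := h.2 z₀ hz₀l
  have h2 : Real.cosh (dist p t) ≤ Real.cosh (dist p z₀) := by
    rw [Real.cosh_le_cosh, abs_of_nonneg dist_nonneg, abs_of_nonneg dist_nonneg]; exact h1
  rw [hdist t h.1, hdist z₀ hz₀l, dist_self, Real.cosh_zero] at h2
  have h3 : z₀ = t := dist_eq_zero.mp (cosh_eq_one_imp (le_of_mul_le_mul_left h2 hs))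
  have h4 := hdist t h.1
  rw [h3, dist_self, Real.cosh_zero, mul_one] at h4
  rw [h4, ← h3]
  exact hpe

namespace IsConvexPolygon

lemma natCast_ne {n a b : ℕ} (ha : a < n) (hb : b < n) (hab : a ≠ b) :
    (a : ZMod n) ≠ b := by
  intro h
  rw [ZMod.natCast_eq_natCast_iff', Nat.mod_eq_of_lt ha, Nat.mod_eq_of_lt hb] at h
  exact hab h

lemma add_natCast_ne {n a b : ℕ} (ha : a < n) (hb : b < n) (hab : a ≠ b) (i : ZMod n) :
    i + a ≠ i + b := fun h => natCast_ne ha hb hab (add_left_cancel h)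

variable {n : ℕ} {P : Set ℍ} {v : ZMod n → ℍ} (h : IsConvexPolygon P v)
include h

lemma mem (i : ZMod n) : v i ∈ P := by
  rw [h.eq_hull]; exact subset_hull _ ⟨i, rfl⟩

lemma not_mem_seg {i j l : ZMod n} (hij : i ≠ j) (hil : i ≠ l) : v i ∉ seg (v j) (v l) := by
  intro hmem
  refine h.vertex i (isConvex_hull _ _ ?_ _ ?_ hmem)
  · exact subset_hull _ ⟨⟨j, rfl⟩, fun he => hij (h.injective he).symm⟩
  · exact subset_hull _ ⟨⟨l, rfl⟩, fun he => hil (h.injective he).symm⟩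

lemma det3_ne_zero {i j l : ZMod n} (hij : i ≠ j) (hil : i ≠ l) (hjl : j ≠ l) :
    det3 (emb (v i)) (emb (v j)) (emb (v l)) ≠ 0 := by
  intro h0
  rcases emb_collinear (h.injective.ne hij) h0 with h1 | h1 | h1
  · exact h.not_mem_seg hil.symm hjl.symm h1
  · exact h.not_mem_seg hij.symm hjl h1
  · exact h.not_mem_seg hij hil h1

lemma side_normal {i : ZMod n} (hi : i ≠ i + 1) : ∃ κ : ℝ, κ ≠ 0 ∧
    ∀ z ∈ P, 0 ≤ κ * det3 (emb (v i)) (emb (v (i + 1))) (emb z) := by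
  obtain ⟨l, hl, h1, h2⟩ := h.side i
  obtain ⟨N, hN, hNl, hNP⟩ := hl.exists_normal
  have hE : 1 < Real.cosh (dist (v i) (v (i + 1))) :=
    Real.one_lt_cosh.mpr (dist_pos.mpr (h.injective.ne hi)).ne'
  have hcr : lor (lcross (emb (v i)) (emb (v (i + 1))))
      (lcross (emb (v i)) (emb (v (i + 1)))) ≠ 0 := by
    rw [lor_lcross_lcross, lor_emb_self, lor_emb_self, lor_emb, lor_emb, dist_comm (v (i + 1))]
    nlinarith
  obtain ⟨κ, rfl⟩ := exists_smul_lcross hcr (hNl _ h1) (hNl _ h2)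
  refine ⟨κ, ?_, fun z hz => ?_⟩
  · rintro rfl
    simp at hN
  · have := hNP z hz
    rwa [lor_smul_left] at this

/-- All sides have the polygon on the same side. -/
lemma exists_orientation (hn : 3 ≤ n) : ∃ ε : ℝ, ε ^ 2 = 1 ∧ ∀ i l, l ≠ i → l ≠ i + 1 →
    0 < ε * det3 (emb (v i)) (emb (v (i + 1))) (emb (v l)) := by
  have hne : ∀ i : ZMod n, i ≠ i + 1 ∧ i ≠ i + 2 ∧ i + 1 ≠ i + 2 := by
    intro i
    have h1 := add_natCast_ne (n := n) (a := 0) (b := 1) (by omega) (by omega) (by omega) i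
    have h2 := add_natCast_ne (n := n) (a := 0) (b := 2) (by omega) (by omega) (by omega) i
    have h3 := add_natCast_ne (n := n) (a := 1) (b := 2) (by omega) (by omega) (by omega) i
    push_cast at h1 h2 h3
    rw [add_zero] at h1 h2
    exact ⟨h1, h2, h3⟩
  set D : ZMod n → ZMod n → ℝ := fun i l => det3 (emb (v i)) (emb (v (i + 1))) (emb (v l))
  have hpos : ∀ i l l', l ≠ i → l ≠ i + 1 → l' ≠ i → l' ≠ i + 1 → 0 < D i l * D i l' := by
    intro i l l' h1 h2 h3 h4
    obtain ⟨κ, hκ, hP⟩ := h.side_normal (hne i).1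
    have a1 : 0 ≤ κ * D i l := hP _ (h.mem l)
    have a2 : 0 ≤ κ * D i l' := hP _ (h.mem l')
    have b1 : D i l ≠ 0 := h.det3_ne_zero (hne i).1 h1.symm h2.symm
    have b2 : D i l' ≠ 0 := h.det3_ne_zero (hne i).1 h3.symm h4.symm
    have hκ2 : 0 < κ ^ 2 := by positivity
    have h5 : 0 ≤ κ ^ 2 * (D i l * D i l') := by
      have := mul_nonneg a1 a2
      linarith
    have h6 := nonneg_of_mul_nonneg_right h5 hκ2
    exact lt_of_le_of_ne h6 (mul_ne_zero b1 b2).symm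
  -- Sides `i` and `i + 1` share the triangle `i`, `i + 1`, `i + 2`, so the sign passes from each
  -- side to the next.
  have hstep : ∀ i, 0 < D i (i + 2) * D (i + 1) (i + 1 + 2) := by
    intro i
    have e : D (i + 1) i = D i (i + 2) := by
      simp only [D]
      rw [show i + 1 + 1 = i + 2 by ring, det3_rotate]
    rw [← e]
    have h1 := hne i
    have h2 := hne (i + 1)
    have e2 : i + 1 + 1 = i + 2 := by ring
    exact hpos (i + 1) i (i + 1 + 2) h1.1 (by rw [e2]; exact h1.2.1) h2.2.1.symm h2.2.2.symm
  have h0 : D 0 (0 + 2) ≠ 0 := h.det3_ne_zero (hne 0).1 (hne 0).2.1 (hne 0).2.2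
  have hall : ∀ m : ℕ, 0 < D 0 (0 + 2) * D m (m + 2) := by
    intro m
    induction m with
    | zero => rw [Nat.cast_zero, ← sq]; positivity
    | succ m ih =>
      have h1 := hstep m
      have h2 : 0 < (D m (m + 2)) ^ 2 * (D 0 (0 + 2) * D ((m : ZMod n) + 1) (m + 1 + 2)) := by
        have := mul_pos ih h1
        linarith
      push_cast
      exact pos_of_mul_pos_right h2 (sq_nonneg _)
  have : NeZero n := ⟨by omega⟩
  refine ⟨D 0 (0 + 2) / |D 0 (0 + 2)|, ?_, fun i l h1 h2 => ?_⟩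
  · rw [div_pow, sq_abs, div_self (by positivity)]
  · have h3 := hall i.val
    rw [ZMod.natCast_zmod_val] at h3
    have h4 := hpos i (i + 2) l (hne i).2.1.symm (hne i).2.2.symm h1 h2
    have h5 : 0 < (D i (i + 2)) ^ 2 * (D 0 (0 + 2) * D i l) := by
      have := mul_pos h3 h4
      linarith
    have h6 := pos_of_mul_pos_right h5 (sq_nonneg _)
    rw [div_mul_eq_mul_div]
    exact div_pos h6 (abs_pos.mpr h0)

/-- The vertices are in convex position, in cyclic order. -/
lemma exists_cyclic_orientation (hn : 3 ≤ n) : ∃ ε : ℝ, ε ^ 2 = 1 ∧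
    ∀ (i : ZMod n) (a b : ℕ), 0 < a → a < b → b < n →
      0 < ε * det3 (emb (v i)) (emb (v (i + a))) (emb (v (i + b))) := by
  obtain ⟨ε, hε, hor⟩ := h.exists_orientation hn
  refine ⟨ε, hε, fun i a b ha hab hb => ?_⟩
  have hcast : ∀ m : ℕ, i + (m : ZMod n) + 1 = i + ((m + 1 : ℕ) : ZMod n) := fun m => by
    push_cast; ring
  have hi0 : ∀ m : ℕ, 0 < m → m < n → i ≠ i + m := fun m h1 h2 => by
    have := add_natCast_ne (n := n) (a := 0) (b := m) (by omega) h2 (by omega) i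
    simpa using this
  have edge : ∀ m : ℕ, 0 < m → m + 1 < n →
      0 < ε * det3 (emb (v i)) (emb (v (i + m))) (emb (v (i + ((m + 1 : ℕ) : ZMod n)))) := by
    intro m h1 h2
    have := hor (i + m) i (hi0 m h1 (by omega)) (by rw [hcast]; exact hi0 _ (by omega) h2)
    rwa [hcast, det3_rotate] at this
  have first : ∀ m : ℕ, 1 < m → m < n →
      0 < ε * det3 (emb (v i)) (emb (v (i + 1))) (emb (v (i + m))) := by
    intro m h1 h2
    refine hor i (i + m) (hi0 m (by omega) h2).symm ?_
    have := add_natCast_ne h2 (show 1 < n by omega) (by omega) i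
    simpa using this
  rcases (show 1 ≤ a from ha).eq_or_lt with rfl | ha1
  · rw [Nat.cast_one]
    exact first b hab hb
  induction b, hab using Nat.le_induction with
  | base => exact edge a ha hb
  | succ b hab ih =>
    have h1 := ih (by omega)
    have h2 := edge b (by omega) hb
    have h3 := first a ha1 (by omega)
    have h4 := first b (by omega) (by omega)
    have h5 := first (b + 1) (by omega) hb
    have hpl := det3_plucker (emb (v (i + a))) (emb (v (i + b)))
      (emb (v (i + ((b + 1 : ℕ) : ZMod n)))) (emb (v i)) (emb (v (i + 1)))
    -- In the Plücker relation seen from `v i`, only the determinant with `i + a` and `i + b + 1`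
    -- has a sign still unknown.
    have h6 : (ε * det3 (emb (v i)) (emb (v (i + 1))) (emb (v (i + b)))) *
        (ε * det3 (emb (v i)) (emb (v (i + a))) (emb (v (i + ((b + 1 : ℕ) : ZMod n))))) =
        (ε * det3 (emb (v i)) (emb (v (i + 1))) (emb (v (i + a)))) *
        (ε * det3 (emb (v i)) (emb (v (i + b))) (emb (v (i + ((b + 1 : ℕ) : ZMod n))))) +
        (ε * det3 (emb (v i)) (emb (v (i + 1))) (emb (v (i + ((b + 1 : ℕ) : ZMod n))))) *
        (ε * det3 (emb (v i)) (emb (v (i + a))) (emb (v (i + b)))) := by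
      linear_combination (-ε ^ 2) * hpl
    refine pos_of_mul_pos_right (a := ε * det3 (emb (v i)) (emb (v (i + 1))) (emb (v (i + b))))
      ?_ h4.le
    rw [h6]
    positivity

/-- In the hyperboloid model, some linear form vanishes at a given vertex and is positive at the
others. -/
lemma exists_exposing (hn : 3 ≤ n) (i : ZMod n) :
    ∃ N, lor N (emb (v i)) = 0 ∧ ∀ l, l ≠ i → 0 < lor N (emb (v l)) := by
  obtain ⟨ε, -, hor⟩ := h.exists_orientation hn
  have hi : i - 1 + 1 = i := by ring
  have hne : ∀ i : ZMod n, i ≠ i + 1 := fun i => by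
    have := add_natCast_ne (n := n) (a := 0) (b := 1) (by omega) (by omega) (by omega) i
    simpa using this
  have hne2 : i - 1 ≠ i + 1 := by
    have := add_natCast_ne (n := n) (a := 0) (b := 2) (by omega) (by omega) (by omega) (i - 1)
    intro he
    apply this
    push_cast
    linear_combination he
  -- The sum of the inner normals of the two sides meeting at `v i` is taken.
  refine ⟨ε • lcross (emb (v (i - 1))) (emb (v i)) + ε • lcross (emb (v i)) (emb (v (i + 1))),
    ?_, fun l hl => ?_⟩
  · rw [lor_add_left, lor_smul_left, lor_smul_left, lor_lcross_left, lor_lcross_right]; ring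
  · rw [lor_add_left, lor_smul_left, lor_smul_left]
    change 0 < ε * det3 (emb (v (i - 1))) (emb (v i)) (emb (v l)) +
      ε * det3 (emb (v i)) (emb (v (i + 1))) (emb (v l))
    by_cases h1 : l = i - 1
    · have h2 := hor i l hl (by rw [h1]; exact hne2)
      rw [h1, det3_self_left, ← h1]; linarith
    · have h3 := hor (i - 1) l h1 (by rw [hi]; exact hl)
      rw [hi] at h3
      by_cases h4 : l = i + 1
      · rw [h4, det3_self_right, ← h4]; linarith
      · have := hor i l hl h4
        linarith

/-- The diameter is the largest distance of two vertices. -/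
lemma exists_diam_eq [NeZero n] : ∃ i j, Metric.diam P = dist (v i) (v j) ∧
    ∀ a b, dist (v a) (v b) ≤ dist (v i) (v j) := by
  obtain ⟨⟨i, j⟩, hmax⟩ := Finite.exists_max fun q : ZMod n × ZMod n => dist (v q.1) (v q.2)
  simp only [Prod.forall] at hmax
  refine ⟨i, j, le_antisymm ?_ ?_, hmax⟩
  · refine Metric.diam_le_of_forall_dist_le dist_nonneg fun a ha b hb => ?_
    rw [h.eq_hull] at ha hb
    refine dist_le_of_mem_hull ?_ ha hb
    rintro _ ⟨a, rfl⟩ _ ⟨b, rfl⟩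
    exact hmax a b
  · exact Metric.dist_le_diam_of_mem h.body.compact.isBounded (h.mem i) (h.mem j)

end IsConvexPolygon

lemma eq_of_emb_eq_smul {s t : ℍ} {m : ℝ} (hm : 0 ≤ m) (h : emb t = m • emb s) : t = s := by
  have h1 := lor_emb_self t
  rw [h, lor_smul_left, lor_smul_right, lor_emb_self] at h1
  have h2 : m = 1 := by nlinarith
  rw [h2, one_smul] at h
  exact emb_injective h

/-- Adding one boundary point to an open half-space of the hyperboloid model keeps it convex. -/
lemma isConvex_insert_lor_pos {N : Fin 3 → ℝ} {s : ℍ} (hs : lor N (emb s) = 0) :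
    IsConvex {z | z = s ∨ 0 < lor N (emb z)} := by
  have key : ∀ {y z : ℍ} {p q : ℝ}, 0 ≤ p → 0 ≤ q → 0 < lor N (emb y) →
      emb z = p • emb s + q • emb y → z = s ∨ 0 < lor N (emb z) := by
    intro y z p q hp hq hy hz
    rcases hq.eq_or_lt with rfl | hq'
    · rw [zero_smul, add_zero] at hz
      exact Or.inl (eq_of_emb_eq_smul hp hz)
    · right
      rw [hz, lor_add_right, lor_smul_right, lor_smul_right, hs]
      have := mul_pos hq' hy
      linarith
  rintro x (hx | hx) y (hy | hy) z hz
  · left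
    rw [hx, hy] at hz
    have h1 : dist s z + dist z s = dist s s := hz
    rw [dist_self, dist_comm s z] at h1
    exact dist_eq_zero.mp (by linarith)
  · obtain ⟨p, q, hp, hq, he⟩ := exists_comb_of_mem_seg hz
    rw [hx] at he
    exact key hp hq hy he
  · obtain ⟨p, q, hp, hq, he⟩ := exists_comb_of_mem_seg hz
    rw [hy] at he
    exact key hq hp hx (by rw [he, add_comm])
  · exact Or.inr (isConvex_lor_pos N x hx y hy hz)

/-- The foot of the perpendicular from a vertex to the opposite side. -/
lemma exists_foot {w : ℝ} {p a b : ℍ} (hdist : Metric.infDist p (seg a b) = w)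
    (h : ∃ l t, IsLine l ∧ a ∈ l ∧ b ∈ l ∧ IsProjection l p t ∧ t ∈ seg a b \ {a, b}) :
    ∃ t : ℍ, dist p t = w ∧
      (∀ c ∈ ({a, b} : Set ℍ), lor (emb p - Real.cosh w • emb t) (emb c) = 0) ∧
      ∃ q r : ℝ, 0 < q ∧ 0 < r ∧ emb t = q • emb a + r • emb b := by
  obtain ⟨l, t, hl, ha, hb, ht, hts, htne⟩ := h
  obtain ⟨N, hN, rfl⟩ := hl.exists_normal
  have ha' : lor N (emb a) = 0 := ha
  have hb' : lor N (emb b) = 0 := hb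
  have hd : dist p t = w := by
    rw [← hdist]
    refine le_antisymm ((Metric.le_infDist ⟨t, hts⟩).mpr fun s hs => ht.2 s ?_)
      (Metric.infDist_le_dist_of_mem hts)
    obtain ⟨q, r, -, -, he⟩ := exists_comb_of_mem_seg hs
    change lor N (emb s) = 0
    rw [he, lor_add_right, lor_smul_right, lor_smul_right, ha', hb']; ring
  have hpe := ht.emb_eq hN
  rw [hd] at hpe
  refine ⟨t, hd, ?_, ?_⟩
  · have e : emb p - Real.cosh w • emb t = lor (emb p) N • N := by
      conv_lhs => rw [hpe]
      module
    rintro c (rfl | rfl)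
    · rw [e, lor_smul_left, ha', mul_zero]
    · rw [e, lor_smul_left, hb', mul_zero]
  · obtain ⟨q, r, hq, hr, he⟩ := exists_comb_of_mem_seg hts
    refine ⟨q, r, lt_of_le_of_ne hq fun h0 => htne ?_, lt_of_le_of_ne hr fun h0 => htne ?_, he⟩
    · rw [← h0, zero_smul, zero_add] at he
      exact Or.inr (eq_of_emb_eq_smul hr he)
    · rw [← h0, zero_smul, add_zero] at he
      exact Or.inl (eq_of_emb_eq_smul hq he)

/-- The minimal width matters only as the common value `w` of the heights. The vector `x i - C • z
i` is normal to the opposite side, hence a multiple of the cross product of its ends; the vertex `x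
i` fixes the sign, and the cyclic orientation gives `height`. -/
lemma IsConvexPolygon.exists_config {k : ℕ} (hk : 1 ≤ k) {P : Set ℍ} {w : ℝ}
    {v : ZMod (2 * k + 1) → ℍ} (hP : IsConvexPolygon P v)
    (hv : ∀ i, Metric.infDist (v i) (seg (v (i + k)) (v (i + k + 1))) = w ∧
      ∃ l t, IsLine l ∧ v (i + k) ∈ l ∧ v (i + k + 1) ∈ l ∧ IsProjection l (v i) t ∧
        t ∈ seg (v (i + k)) (v (i + k + 1)) \ {v (i + k), v (i + k + 1)}) :
    ∃ ε z, IsReducedConfig k (Real.cosh w) ε (fun i => emb (v i)) z := by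
  obtain ⟨ε, hε, hor⟩ := hP.exists_cyclic_orientation (by omega)
  choose t ht hperp hfoot using fun i => exists_foot (hv i).1 (hv i).2
  have hk1 : ∀ i : ZMod (2 * k + 1), i + k + 1 = i + ((k + 1 : ℕ) : ZMod (2 * k + 1)) :=
    fun i => by push_cast; ring
  have hopp : ∀ i, 0 < ε * det3 (emb (v (i + k))) (emb (v (i + k + 1))) (emb (v i)) := by
    intro i
    have := hor i k (k + 1) (by omega) (by omega) (by omega)
    rwa [← hk1, ← det3_rotate] at this
  have hC : 1 < Real.cosh w := by
    refine Real.one_lt_cosh.mpr fun hw => ?_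
    have hvt : v 0 = t 0 := dist_eq_zero.mp ((ht 0).trans hw)
    obtain ⟨q, r, -, -, he⟩ := hfoot 0
    have h1 := hopp 0
    rw [show emb (v 0) = q • emb (v (0 + k)) + r • emb (v (0 + k + 1)) by rw [hvt, he]] at h1
    simp only [det3, lor_add_right, lor_smul_right, lor_lcross_left, lor_lcross_right] at h1
    simp at h1
  refine ⟨ε, fun i => emb (t i), hk, hC, fun i => lor_emb_self _, fun i => lor_emb_self _,
    fun i => by rw [lor_emb, ht], fun i j => ?_, fun i => hperp i _ (Or.inl rfl),
    fun i => hperp i _ (Or.inr rfl), hfoot, fun i j => ?_, hε, hor⟩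
  · rw [lor_emb]
    linarith [Real.one_le_cosh (dist (v i) (v j))]
  · have hne : v (i + k) ≠ v (i + k + 1) := fun he => by
      have := hopp i
      rw [← he, det3, lor_comm] at this
      have h2 : lcross (emb (v (i + k))) (emb (v (i + k))) = 0 := by
        funext m
        fin_cases m <;> simp [lcross] <;> ring
      rw [h2, lor_comm] at this
      simp at this
    have hcr : lor (lcross (emb (v (i + k))) (emb (v (i + k + 1))))
        (lcross (emb (v (i + k))) (emb (v (i + k + 1)))) ≠ 0 := by
      rw [lor_lcross_lcross, lor_emb_self, lor_emb_self, lor_emb, lor_emb,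
        dist_comm (v (i + k + 1))]
      nlinarith [Real.one_lt_cosh.mpr (dist_pos.mpr hne).ne']
    obtain ⟨κ, hκ⟩ := exists_smul_lcross hcr (hperp i _ (Or.inl rfl)) (hperp i _ (Or.inr rfl))
    have h1 : 0 < κ * det3 (emb (v (i + k))) (emb (v (i + k + 1))) (emb (v i)) := by
      have : lor (emb (v i) - Real.cosh w • emb (t i)) (emb (v i)) =
          κ * det3 (emb (v (i + k))) (emb (v (i + k + 1))) (emb (v i)) := by
        rw [hκ, lor_smul_left]; rfl
      rw [← this, lor_sub_left, lor_smul_left, lor_emb_self, lor_emb, dist_comm, ht]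
      nlinarith
    have h2 : lor (emb (v i) - Real.cosh w • emb (t i)) (emb (v j)) =
        κ * det3 (emb (v (i + k))) (emb (v (i + k + 1))) (emb (v j)) := by
      rw [hκ, lor_smul_left]; rfl
    rw [h2]
    have hκε : 0 < κ * ε := by
      have h3 : 0 < (κ * ε) *
          det3 (emb (v (i + k))) (emb (v (i + k + 1))) (emb (v i)) ^ 2 := by
        have := mul_pos h1 (hopp i)
        linarith
      exact pos_of_mul_pos_left h3 (sq_nonneg _)
    have h3 : 0 ≤ ε * det3 (emb (v (i + k))) (emb (v (i + k + 1))) (emb (v j)) := by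
      have hn0 : NeZero (2 * k + 1) := ⟨by omega⟩
      obtain ⟨m, hm, hmj⟩ : ∃ m : ℕ, m < 2 * k + 1 ∧ j = i + k + m :=
        ⟨(j - (i + k)).val, ZMod.val_lt _, by rw [ZMod.natCast_zmod_val]; ring⟩
      rcases Nat.lt_or_ge 1 m with h4 | h4
      · have := hor (i + k) 1 m one_pos h4 hm
        rw [Nat.cast_one] at this
        rw [hmj]
        exact this.le
      · interval_cases m
        · rw [hmj, Nat.cast_zero, add_zero, det3_self_left, mul_zero]
        · rw [hmj, Nat.cast_one, det3_self_right, mul_zero]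
    have h4 : 0 ≤ (κ * ε) *
        (ε * det3 (emb (v (i + k))) (emb (v (i + k + 1))) (emb (v j))) :=
      mul_nonneg hκε.le h3
    linear_combination h4 + κ * det3 (emb (v (i + k))) (emb (v (i + k + 1))) (emb (v j)) * hε

/-- The vertices of a polygon are among the points it is the convex hull of. -/
lemma IsConvexPolygon.vertex_mem {n : ℕ} (hn : 3 ≤ n) {P : Set ℍ} {v : ZMod n → ℍ}
    (hP : IsConvexPolygon P v) {X : Set ℍ} (hX : P = hull X) (i : ZMod n) : v i ∈ X := by
  obtain ⟨N, hN0, hN⟩ := hP.exists_exposing hn i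
  by_contra hcon
  -- An open half-plane with the single boundary point `v i` is convex. If `X` omitted `v i`, its
  -- hull would lie in the open half-plane.
  have hPY : P ⊆ {z | z = v i ∨ 0 < lor N (emb z)} := by
    rw [hP.eq_hull]
    refine hull_subset (isConvex_insert_lor_pos hN0) ?_
    rintro _ ⟨l, rfl⟩
    by_cases hl : l = i
    · exact Or.inl (by rw [hl])
    · exact Or.inr (hN l hl)
  have hpos : X ⊆ {z | 0 < lor N (emb z)} := by
    intro z hz
    rcases hPY (hX ▸ subset_hull X hz) with rfl | h0
    · exact absurd hz hcon
    · exact h0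
  have h1 := hull_subset (isConvex_lor_pos N) hpos (hX ▸ hP.mem i)
  have h2 : 0 < lor N (emb (v i)) := h1
  linarith

/-- The solution of `2 c² = C c + 1`, the hyperbolic cosine of half the side of the regular triangle
of height `arcosh C`. -/
lemma half_side_spec {C : ℝ} (hC : 1 < C) :
    1 < (C + √(C ^ 2 + 8)) / 4 ∧
      2 * ((C + √(C ^ 2 + 8)) / 4) ^ 2 = C * ((C + √(C ^ 2 + 8)) / 4) + 1 := by
  have h1 := Real.sq_sqrt (show 0 ≤ C ^ 2 + 8 by positivity)
  have h2 : 3 < √(C ^ 2 + 8) := by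
    rw [Real.lt_sqrt (by norm_num)]
    nlinarith
  set r := √(C ^ 2 + 8)
  constructor
  · linarith
  · linear_combination h1 / 8

end Hyp

end

theorem theorem1p1 (P : Set UpperHalfPlane) (w : ℝ) (hP : Hyp.IsOrdinaryReducedPolygon P)
    (hw : Hyp.minWidth P = w) :
    Metric.diam P ≤
        2 * Real.arcosh ((Real.cosh w + √(Real.cosh w ^ 2 + 8)) / 4) ∧
      (Metric.diam P = 2 * Real.arcosh ((Real.cosh w + √(Real.cosh w ^ 2 + 8)) / 4) ↔
        Hyp.IsRegularTriangle P) := by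
  obtain ⟨k, hk, v, hv, hred⟩ := hP
  rw [hw] at hred
  obtain ⟨ε, z, hcfg⟩ := hv.exists_config hk hred
  obtain ⟨hc, hcC⟩ := Hyp.half_side_spec hcfg.one_lt
  set c := (Real.cosh w + √(Real.cosh w ^ 2 + 8)) / 4
  have hD0 : 0 ≤ 2 * Real.arcosh c := by
    have := Real.arcosh_nonneg hc.le
    positivity
  -- `cosh (2 arcosh c) = 2 c² - 1`, which is `C c` by the choice of `c`.
  have hcosh : Real.cosh (2 * Real.arcosh c) = Real.cosh w * c := by
    rw [Real.cosh_two_mul, Real.cosh_arcosh hc.le, Real.sinh_arcosh hc.le,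
      Real.sq_sqrt (by nlinarith)]
    linarith
  have hdist : ∀ i j, Real.cosh (dist (v i) (v j)) =
      -Hyp.lor (Hyp.emb (v i)) (Hyp.emb (v j)) := fun i j => by rw [Hyp.lor_emb, neg_neg]
  have hn0 : NeZero (2 * k + 1) := ⟨by omega⟩
  obtain ⟨i, j, hdiam, hmax⟩ := hv.exists_diam_eq
  have hle_iff : ∀ a b, dist (v a) (v b) ≤ 2 * Real.arcosh c ↔
      -Hyp.lor (Hyp.emb (v a)) (Hyp.emb (v b)) ≤ Real.cosh w * c := fun a b => by
    rw [← hdist, ← hcosh, Real.cosh_le_cosh, abs_of_nonneg dist_nonneg, abs_of_nonneg hD0]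
  have heq_iff : ∀ a b, dist (v a) (v b) = 2 * Real.arcosh c ↔
      -Hyp.lor (Hyp.emb (v a)) (Hyp.emb (v b)) = Real.cosh w * c := fun a b => by
    rw [← hdist, ← hcosh]
    exact ⟨fun h => by rw [h], fun h => Hyp.cosh_inj dist_nonneg hD0 h⟩
  have hcard : k = 1 ∨ 2 ≤ k := by omega
  rw [hdiam]
  refine ⟨(hle_iff i j).mpr ?_, fun h => ?_, ?_⟩
  · rcases hcard with hk1 | hk2
    · exact hcfg.neg_lor_le_of_triangle hk1 hc hcC i j
    · exact (hcfg.neg_lor_lt hk2 hc hcC i j).le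
  · rw [heq_iff] at h
    rcases hcard with hk1 | hk2
    · have hside : ∀ a b, a ≠ b → dist (v a) (v b) = 2 * Real.arcosh c := fun a b hab =>
        (heq_iff a b).mpr (hcfg.triangle_of_eq hk1 hc hcC h hab)
      subst hk1
      have h01 : (0 : ZMod (2 * 1 + 1)) ≠ 1 := by decide
      have h12 : (1 : ZMod (2 * 1 + 1)) ≠ 2 := by decide
      have h20 : (2 : ZMod (2 * 1 + 1)) ≠ 0 := by decide
      refine ⟨v 0, v 1, v 2, hv.injective.ne h01, ?_, ?_, ?_⟩
      · rw [hside _ _ h01, hside _ _ h12]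
      · rw [hside _ _ h12, hside _ _ h20]
      · rw [hv.eq_hull]
        congr 1
        ext y
        constructor
        · rintro ⟨a, rfl⟩
          have : a = 0 ∨ a = 1 ∨ a = 2 := by revert a; decide
          rcases this with rfl | rfl | rfl <;> simp
        · rintro (rfl | rfl | rfl) <;> exact ⟨_, rfl⟩
    · exact absurd h (hcfg.neg_lor_lt hk2 hc hcC i j).ne
  · rintro ⟨A, B, D, hAB, h1, h2, hPh⟩
    have hmem := fun a => hv.vertex_mem (by omega) hPh a
    have hk1 : k = 1 := by
      -- All `2 * k + 1` vertices are among the three points spanning the triangle.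
      have h3 : Nat.card (ZMod (2 * k + 1)) ≤ Nat.card ({A, B, D} : Set UpperHalfPlane) :=
        Nat.card_le_card_of_injective (fun a => ⟨v a, hmem a⟩) fun a b hab =>
          hv.injective (congrArg Subtype.val hab)
      rw [Nat.card_zmod, Nat.card_coe_set_eq] at h3
      have h4 : ({A, B, D} : Set _).ncard ≤ 3 := by
        refine (Set.ncard_insert_le _ _).trans ?_
        have := Set.ncard_insert_le B {D}
        rw [Set.ncard_singleton] at this
        omega
      omega
    have hside : ∀ a b, a ≠ b → dist (v a) (v b) = dist A B := by
      intro a b hab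
      have h3 := hv.injective.ne hab
      have ha := hmem a
      have hb := hmem b
      simp only [Set.mem_insert_iff, Set.mem_singleton_iff] at ha hb
      have h4 := dist_comm A B
      have h5 := dist_comm B D
      have h6 := dist_comm D A
      rcases ha with ha | ha | ha <;> rcases hb with hb | hb | hb <;> rw [ha, hb] at h3 ⊢ <;>
        first | exact absurd rfl h3 | linarith
    have hE := hcfg.eq_of_equilateral hk1 hc hcC (E := Real.cosh (dist A B)) fun a b hab => by
      rw [← hdist, hside a b hab]
    have hij : i ≠ j := by
      rintro rfl
      have h01 : (0 : ZMod (2 * k + 1)) ≠ 1 := by subst hk1; decide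
      have := hmax 0 1
      rw [dist_self] at this
      exact hv.injective.ne h01 (dist_eq_zero.mp (le_antisymm this dist_nonneg))
    rw [heq_iff, ← hE, ← hdist, hside i j hij]
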